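/- Theorem (Kwang-Wu Yang, generalized). Let $(M_1,g_1),\dots,(M_l,g_l)$ be smooth Riemannian manifolds (without boundary), let $M=M_1\times\cdots\times M_l$, let $f_1,\dots,f_l\colon M\to(0,\infty)$ be smooth functions, and consider on $M$ the Riemannian metric $$\tilde g=f_1^2g_1\oplus\cdots\oplus f_l^2g_l=\sum_{i=1}^l f_i^2\,\pi_i^*g_i ,$$ where $\pi_i\colon M\to M_i$ is the projection. Assume that there is a permutation $\sigma$ of $\{1,\dots,l\}$ such that, for every $i$, $\sigma(i)\neq i$ and $f_i$ is constant along $M_1\times\cdots\times M_{\sigma(i)-1}\times M_{\sigma(i)+1}\times\cdots\times M_l$, i.e. $f_i(x)$ depends only on the component of $x$ in $M_{\sigma(i)}$. If the scalar curvature $R^{\tilde g}$ is constant on $M$, and if $f_i$ is nonconstant for every $i\in\{1,\dots,l\}$, then $R^{\tilde g}=0$ on $M$. -/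

import Mathlib

open scoped Manifold ContDiff

noncomputable section

namespace MulticonformalScalar

section LocalCoordinates

/-! ### Curvature of a metric written in coordinates

Here `E` is a finite-dimensional real vector space with basis `b`, which supplies linear coordinates
`u = ∑ a, u_a • b a`, and `G : E → Matrix ι ι ℝ` is the matrix `(g_ab)` of a metric as a function of
the coordinates. -/

variable {ι E : Type*} [Fintype ι] [DecidableEq ι] [NormedAddCommGroup E] [NormedSpace ℝ E]

/-- The partial derivative `∂_a h` at `u`. -/
def partialDeriv (b : Module.Basis ι ℝ E) (a : ι) (h : E → ℝ) (u : E) : ℝ :=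
  fderiv ℝ h u (b a)

/-- The Christoffel symbols
`Γ^d_{ac} = (1/2) ∑ e, g^{de} (∂_a g_{ce} + ∂_c g_{ae} - ∂_e g_{ac})`. -/
def christoffel (b : Module.Basis ι ℝ E) (G : E → Matrix ι ι ℝ) (d a c : ι) (u : E) : ℝ :=
  (1 / 2) * ∑ e, (G u)⁻¹ d e *
    (partialDeriv b a (fun v => G v c e) u + partialDeriv b c (fun v => G v a e) u
      - partialDeriv b e (fun v => G v a c) u)

/-- The component `R^d` of `R(∂_a, ∂_c) ∂_e = ∇_a ∇_c ∂_e - ∇_c ∇_a ∂_e`, that is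
`∂_a Γ^d_{ce} - ∂_c Γ^d_{ae} + ∑ p, (Γ^d_{ap} Γ^p_{ce} - Γ^d_{cp} Γ^p_{ae})`. -/
def riemannCoord (b : Module.Basis ι ℝ E) (G : E → Matrix ι ι ℝ) (d a c e : ι) (u : E) : ℝ :=
  partialDeriv b a (christoffel b G d c e) u - partialDeriv b c (christoffel b G d a e) u
    + ∑ p, (christoffel b G d a p u * christoffel b G p c e u
      - christoffel b G d c p u * christoffel b G p a e u)

/-- The Ricci tensor `Ric_{ce}`, the trace of `X ↦ R(X, ∂_c) ∂_e`. -/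
def ricciCoord (b : Module.Basis ι ℝ E) (G : E → Matrix ι ι ℝ) (c e : ι) (u : E) : ℝ :=
  ∑ a, riemannCoord b G a a c e u

/-- The scalar curvature `∑ c e, g^{ce} Ric_{ce}`. -/
def scalarCoord (b : Module.Basis ι ℝ E) (G : E → Matrix ι ι ℝ) (u : E) : ℝ :=
  ∑ c, ∑ e, (G u)⁻¹ c e * ricciCoord b G c e u

end LocalCoordinates

section Manifold

variable {ι E H M : Type*} [Fintype ι] [DecidableEq ι] [NormedAddCommGroup E] [NormedSpace ℝ E]
  [TopologicalSpace H] [TopologicalSpace M] [ChartedSpace H M]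

/-- The matrix `g_ac(u) = g(∂_a, ∂_c)` of a metric tensor `g` on `M` in the preferred chart `φ`
around `x`, where `∂_a = d(φ⁻¹)_u (b a)` is the coordinate vector at the point `φ⁻¹ u`. -/
def metricMatrix (I : ModelWithCorners ℝ E H) (b : Module.Basis ι ℝ E)
    (g : ∀ y : M, LinearMap.BilinForm ℝ (TangentSpace I y)) (x : M) (u : E) : Matrix ι ι ℝ :=
  Matrix.of fun a c =>
    g ((extChartAt I x).symm u)
      (mfderiv 𝓘(ℝ, E) I (extChartAt I x).symm u (b a))
      (mfderiv 𝓘(ℝ, E) I (extChartAt I x).symm u (b c))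

/-- The scalar curvature at `x` of a smooth metric tensor `g` on a manifold without boundary,
computed in the coordinates given by the preferred chart around `x` and the basis `b` of the model
space. (Scalar curvature does not depend on the choice of coordinates.) -/
def scalarCurvature (I : ModelWithCorners ℝ E H) (b : Module.Basis ι ℝ E)
    (g : ∀ y : M, LinearMap.BilinForm ℝ (TangentSpace I y)) (x : M) : ℝ :=
  scalarCoord b (metricMatrix I b g x) (extChartAt I x x)

end Manifold

section Product

variable {l : ℕ} (m : Fin l → ℕ)

/-- The model with corners (without boundary) of a product of manifolds of dimensions `m i`. -/
abbrev prodModel :=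
  ModelWithCorners.pi (fun i : Fin l => 𝓡 (m i))

/-- The standard basis of `∏ i, ℝ^(m i)`. -/
def prodBasis : Module.Basis (Σ i : Fin l, Fin (m i)) ℝ
    (∀ i : Fin l, EuclideanSpace ℝ (Fin (m i))) :=
  Pi.basis fun i => (EuclideanSpace.basisFun (Fin (m i)) ℝ).toBasis

/-- A smooth Riemannian metric on a smooth manifold of dimension `n`. -/
abbrev RiemMetric (n : ℕ) (N : Type*) [TopologicalSpace N]
    [ChartedSpace (EuclideanSpace ℝ (Fin n)) N] [IsManifold (𝓡 n) ∞ N] :=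
  Bundle.ContMDiffRiemannianMetric (𝓡 n) ∞ (EuclideanSpace ℝ (Fin n))
    (fun p : N => TangentSpace (𝓡 n) p)

variable {m} {M : Fin l → Type*} [∀ i, TopologicalSpace (M i)]
  [∀ i, ChartedSpace (EuclideanSpace ℝ (Fin (m i))) (M i)]
  [∀ i, IsManifold (𝓡 (m i)) ∞ (M i)]

/-- The metric `f₁² g₁ ⊕ ⋯ ⊕ f_l² g_l = ∑ i, f_i² π_i^* g_i` on `M = ∏ i, M i`, where
`π_i : M → M i` is the projection. -/
def multiconformalMetric (g : ∀ i, RiemMetric (m i) (M i)) (f : Fin l → (∀ i, M i) → ℝ)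
    (x : ∀ i, M i) : LinearMap.BilinForm ℝ (TangentSpace (prodModel m) x) :=
  LinearMap.mk₂ ℝ
    (fun v w => ∑ i, f i x ^ 2 *
      (g i).inner (x i)
        (mfderiv (prodModel m) (𝓡 (m i)) (fun y : ∀ i, M i => y i) x v)
        (mfderiv (prodModel m) (𝓡 (m i)) (fun y : ∀ i, M i => y i) x w))
    (by intro v v' w; simp [mul_add, Finset.sum_add_distrib])
    (by intro c v w; simp [Finset.mul_sum, mul_left_comm])
    (by intro v w w'; simp [mul_add, Finset.sum_add_distrib])
    (by intro c v w; simp [Finset.mul_sum, mul_left_comm])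

end Product

end MulticonformalScalar

end

/-! In product coordinates the metric is block diagonal, and its `i`-th block is the matrix of `g i`
times a positive function of the coordinate in `M (σ i)` alone. Let `L_a = G⁻¹ ∂_a G`. For `a` a
direction in `M k`, the only nonzero blocks of `L_a` are block `k`, where the scale factor cancels,
and block `σ⁻¹ k`, where a logarithmic derivative multiplies the identity. Both depend on `x k`
only. Scalar curvature can be written through `G⁻¹`, the `L_a` and derivatives of their contractions
(`scalarCoord_eq`), so it takes the separated form `∑ k, a (σ k) (x (σ k)) * S k (x k)` with `a k =
(φ k ^ 2)⁻¹` (`IsTwistedProduct.scalarCoord_eq_sum`).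

The rest is algebra (`eq_zero_of_sum_eq`), in which `S k` may be any function. If such a sum is a
constant `c`, moving only `x k` changes two terms, which gives a relation between the variations of
`a k` and `S k`. Along a cycle of `σ` longer than two the variables in this relation are
independent, and nonconstancy of `a` forces `S = 0`. On a 2-cycle the two terms cancel each other.
In either case the terms at `k` and `σ k` add up to zero. Summing over `k` gives `2 * c = 0`. -/

set_option linter.unusedSectionVars false

noncomputable section

namespace MulticonformalScalar

/-! ### Index algebra: contractions of Christoffel symbols and of metric derivatives -/

section Contraction

variable {ι : Type*} [Fintype ι]

/-- The full contraction of two covariant 3-tensors by means of `H` in each slot. -/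
def contract (H : Matrix ι ι ℝ) (P Q : ι × ι × ι → ℝ) : ℝ :=
  ∑ x, ∑ y, H x.1 y.1 * H x.2.1 y.2.1 * H x.2.2 y.2.2 * (P x * Q y)

theorem contract_add_left (H : Matrix ι ι ℝ) (P P' Q : ι × ι × ι → ℝ) :
    contract H (P + P') Q = contract H P Q + contract H P' Q := by
  simp only [contract, ← Finset.sum_add_distrib, Pi.add_apply]
  exact Finset.sum_congr rfl fun x _ => Finset.sum_congr rfl fun y _ => by ring

theorem contract_sub_left (H : Matrix ι ι ℝ) (P P' Q : ι × ι × ι → ℝ) :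
    contract H (P - P') Q = contract H P Q - contract H P' Q := by
  simp only [contract, ← Finset.sum_sub_distrib, Pi.sub_apply]
  exact Finset.sum_congr rfl fun x _ => Finset.sum_congr rfl fun y _ => by ring

theorem contract_comm {H : Matrix ι ι ℝ} (hH : H.IsSymm) (P Q : ι × ι × ι → ℝ) :
    contract H P Q = contract H Q P := by
  rw [contract, contract, Finset.sum_comm]
  refine Finset.sum_congr rfl fun x _ => Finset.sum_congr rfl fun y _ => ?_
  rw [hH.apply x.1 y.1, hH.apply x.2.1, hH.apply x.2.2]
  ring

theorem contract_add_right {H : Matrix ι ι ℝ} (hH : H.IsSymm) (P Q Q' : ι × ι × ι → ℝ) :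
    contract H P (Q + Q') = contract H P Q + contract H P Q' := by
  rw [contract_comm hH, contract_add_left, contract_comm hH P, contract_comm hH P]

theorem contract_sub_right {H : Matrix ι ι ℝ} (hH : H.IsSymm) (P Q Q' : ι × ι × ι → ℝ) :
    contract H P (Q - Q') = contract H P Q - contract H P Q' := by
  rw [contract_comm hH, contract_sub_left, contract_comm hH P, contract_comm hH P]

theorem contract_swap₁₂ (H : Matrix ι ι ℝ) (P Q : ι × ι × ι → ℝ) :
    contract H (fun x => P (x.2.1, x.1, x.2.2)) (fun x => Q (x.2.1, x.1, x.2.2)) =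
      contract H P Q := by
  let s : ι × ι × ι ≃ ι × ι × ι :=
    ⟨fun x => (x.2.1, x.1, x.2.2), fun x => (x.2.1, x.1, x.2.2), fun _ => rfl, fun _ => rfl⟩
  refine Fintype.sum_equiv s _ _ fun x => Fintype.sum_equiv s _ _ fun y => ?_
  simp only [s, Equiv.coe_fn_mk]
  ring

theorem contract_swap₂₃ (H : Matrix ι ι ℝ) (P Q : ι × ι × ι → ℝ) :
    contract H (fun x => P (x.1, x.2.2, x.2.1)) (fun x => Q (x.1, x.2.2, x.2.1)) =
      contract H P Q := by
  let s : ι × ι × ι ≃ ι × ι × ι :=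
    ⟨fun x => (x.1, x.2.2, x.2.1), fun x => (x.1, x.2.2, x.2.1), fun _ => rfl, fun _ => rfl⟩
  refine Fintype.sum_equiv s _ _ fun x => Fintype.sum_equiv s _ _ fun y => ?_
  simp only [s, Equiv.coe_fn_mk]
  ring

theorem contract_eq_sum (H : Matrix ι ι ℝ) (P Q : ι × ι × ι → ℝ) :
    contract H P Q = ∑ a, ∑ b, ∑ c, ∑ a', ∑ b', ∑ c',
      H a a' * H b b' * H c c' * (P (a, b, c) * Q (a', b', c')) := by
  simp only [contract, Fintype.sum_prod_type]

variable {H : Matrix ι ι ℝ} {D : ι → Matrix ι ι ℝ}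

/-- Christoffel symbols as a function of the inverse metric `H` and the derivatives `D` of the
metric. -/
def christoffelAlg (H : Matrix ι ι ℝ) (D : ι → Matrix ι ι ℝ) (d a c : ι) : ℝ :=
  (1 / 2) * ∑ e, H d e * (D a c e + D c a e - D e a c)

theorem christoffelAlg_eq (hD : ∀ a, (D a).IsSymm) (d a c : ι) :
    christoffelAlg H D d a c =
      (1 / 2) * ((H * D a) d c + (H * D c) d a - ∑ e, H d e * D e a c) := by
  simp only [christoffelAlg, Matrix.mul_apply, ← Finset.sum_add_distrib, ← Finset.sum_sub_distrib]
  congr 1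
  refine Finset.sum_congr rfl fun e _ => ?_
  rw [(hD a).apply e c, (hD c).apply e a]
  ring

/-- Two of the three derivative terms cancel by symmetry of `H`. -/
theorem sum_christoffelAlg_self (hH : H.IsSymm) (hD : ∀ a, (D a).IsSymm) (e : ι) :
    ∑ a, christoffelAlg H D a a e = (1 / 2) * (H * D e).trace := by
  simp only [christoffelAlg_eq hD, ← Finset.mul_sum, Finset.sum_sub_distrib,
    Finset.sum_add_distrib, Matrix.trace, Matrix.diag, Matrix.mul_apply]
  rw [Finset.sum_comm (f := fun x i => H x i * D i x e)]
  have : ∀ x i, H i x * D x i e = H x i * D x i e := fun x i => by rw [hH.apply]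
  simp only [this]
  ring

theorem sum_inv_mul_christoffelAlg (hH : H.IsSymm) (hD : ∀ a, (D a).IsSymm) (d : ι) :
    ∑ c, ∑ e, H c e * christoffelAlg H D d c e =
      ∑ a, ∑ c, (H * D a) d c * H c a - ∑ e, H d e * ((1 / 2) * (H * D e).trace) := by
  have h1 : ∑ c, ∑ e, H c e * (H * D c) d e = ∑ a, ∑ c, (H * D a) d c * H c a :=
    Finset.sum_congr rfl fun c _ => Finset.sum_congr rfl fun e _ => by rw [hH.apply e c]; ring
  have h2 : ∑ c, ∑ e, H c e * (H * D e) d c = ∑ a, ∑ c, (H * D a) d c * H c a := by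
    rw [Finset.sum_comm]
    exact Finset.sum_congr rfl fun c _ => Finset.sum_congr rfl fun e _ => by ring
  have h3 : ∑ c, ∑ e, H c e * ∑ f, H d f * D f c e = ∑ e, H d e * (H * D e).trace := by
    simp only [Matrix.trace, Matrix.diag, Matrix.mul_apply, Finset.mul_sum]
    rw [Finset.sum_congr rfl fun c _ => Finset.sum_comm, Finset.sum_comm]
    refine Finset.sum_congr rfl fun f _ => Finset.sum_congr rfl fun c _ =>
      Finset.sum_congr rfl fun e _ => ?_
    rw [(hD f).apply c e]
    ring
  have h4 : ∀ c e, H c e * christoffelAlg H D d c e = (1 / 2) * (H c e * (H * D c) d e +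
      H c e * (H * D e) d c - H c e * ∑ f, H d f * D f c e) := fun c e => by
    rw [christoffelAlg_eq hD]; ring
  simp only [h4, ← Finset.mul_sum, Finset.sum_sub_distrib, Finset.sum_add_distrib, h1, h2, h3]
  have h5 : ∑ e, H d e * ((1 / 2) * (H * D e).trace) =
      (1 / 2) * ∑ e, H d e * (H * D e).trace := by
    rw [Finset.mul_sum]
    exact Finset.sum_congr rfl fun _ _ => by ring
  rw [h5]
  ring

/-- The derivatives of a metric as a 3-tensor, with the derivative index in the first slot. -/
def derivTensor₁ (D : ι → Matrix ι ι ℝ) (x : ι × ι × ι) : ℝ := D x.1 x.2.1 x.2.2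
/-- The tensor `derivTensor₁` with the derivative index in the second slot. -/
def derivTensor₂ (D : ι → Matrix ι ι ℝ) (x : ι × ι × ι) : ℝ := D x.2.1 x.1 x.2.2
/-- The tensor `derivTensor₁` with the derivative index in the third slot. -/
def derivTensor₃ (D : ι → Matrix ι ι ℝ) (x : ι × ι × ι) : ℝ := D x.2.2 x.1 x.2.1

theorem contract_deriv₂₂ : contract H (derivTensor₂ D) (derivTensor₂ D) =
    contract H (derivTensor₁ D) (derivTensor₁ D) :=
  contract_swap₁₂ H (derivTensor₁ D) (derivTensor₁ D)

theorem contract_deriv₃₃ : contract H (derivTensor₃ D) (derivTensor₃ D) =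
    contract H (derivTensor₁ D) (derivTensor₁ D) := by
  rw [← contract_deriv₂₂]
  exact contract_swap₂₃ H (derivTensor₂ D) (derivTensor₂ D)

/-- Together with its neighbours this leaves only two independent quadratic contractions of the
metric derivatives: derivative indices paired with each other, or not. -/
theorem contract_deriv₁₃ (hD : ∀ a, (D a).IsSymm) :
    contract H (derivTensor₁ D) (derivTensor₃ D) =
      contract H (derivTensor₁ D) (derivTensor₂ D) := by
  rw [← contract_swap₂₃ H (derivTensor₁ D) (derivTensor₂ D)]
  congr 1
  funext x
  exact (hD x.1).apply _ _

theorem contract_deriv₂₃ (hD : ∀ a, (D a).IsSymm) :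
    contract H (derivTensor₂ D) (derivTensor₃ D) =
      contract H (derivTensor₁ D) (derivTensor₂ D) := by
  rw [← contract_deriv₁₃ hD,
    ← contract_swap₁₂ H (derivTensor₁ D) (derivTensor₃ D)]
  congr 1
  funext x
  exact (hD x.2.2).apply _ _

theorem sum_inv_mul_trace_eq_contract (hH : H.IsSymm) (hD : ∀ a, (D a).IsSymm) :
    ∑ p, ∑ e, H p e * (H * D p * (H * D e)).trace =
      contract H (derivTensor₁ D) (derivTensor₁ D) := by
  simp only [contract_eq_sum, Matrix.trace, Matrix.diag, Matrix.mul_apply, Finset.mul_sum,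
    Finset.sum_mul, derivTensor₁]
  simp only [← Fintype.sum_prod_type']
  -- `s` renames the six summation indices so that the summands agree up to symmetry of `H` and `D`.
  let s : (ι × ι × ι × ι × ι × ι) ≃ (ι × ι × ι × ι × ι × ι) :=
    ⟨fun (p, e, i, j, k, r) => (p, r, j, e, i, k), fun (a, b, c, a', b', c') =>
      (a, a', b', c, c', b),
      fun _ => rfl, fun _ => rfl⟩
  refine Fintype.sum_equiv s _ _ ?_
  rintro ⟨p, e, i, j, k, r⟩
  simp only [s, Equiv.coe_fn_mk]
  rw [hH.apply i r, (hD e).apply k i]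
  ring

theorem sum_mul_inv_mul_eq_contract (hH : H.IsSymm) :
    ∑ a, ∑ c, ∑ p, ∑ e, (H * D a) c p * H p e * (H * D c) a e =
      contract H (derivTensor₁ D) (derivTensor₂ D) := by
  simp only [contract_eq_sum, Matrix.mul_apply, Finset.mul_sum,
    Finset.sum_mul, derivTensor₁, derivTensor₂]
  simp only [← Fintype.sum_prod_type']
  let s : (ι × ι × ι × ι × ι × ι) ≃ (ι × ι × ι × ι × ι × ι) :=
    ⟨fun (a, c, p, e, r, f) => (a, f, p, r, c, e), fun (a, f, p, r, c, e) => (a, c, p, e, r, f),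
      fun _ => rfl, fun _ => rfl⟩
  refine Fintype.sum_equiv s _ _ ?_
  rintro ⟨a, c, p, e, r, f⟩
  simp only [s, Equiv.coe_fn_mk]
  rw [hH.apply c f]
  ring

/-- The product expands into nine signed pairings of derivative tensors. Mixed pairings count `+2`
in total, equal ones `-1`, with a factor `1/4` from the two Christoffel symbols. -/
theorem sum_inv_mul_christoffelAlg_mul (hH : H.IsSymm) (hD : ∀ a, (D a).IsSymm) :
    ∑ c, ∑ e, ∑ a, ∑ p, H c e * (christoffelAlg H D a c p * christoffelAlg H D p a e) =
      (1 / 2) * contract H (derivTensor₁ D) (derivTensor₂ D)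
        - (1 / 4) * contract H (derivTensor₁ D) (derivTensor₁ D) := by
  have key : ∑ c, ∑ e, ∑ a, ∑ p, H c e * (christoffelAlg H D a c p * christoffelAlg H D p a e) =
      (1 / 4) * contract H (derivTensor₁ D + derivTensor₃ D - derivTensor₂ D)
        (derivTensor₂ D + derivTensor₁ D - derivTensor₃ D) := by
    simp only [contract_eq_sum, christoffelAlg, Finset.mul_sum, Finset.sum_mul, Pi.add_apply,
      Pi.sub_apply, derivTensor₁, derivTensor₂, derivTensor₃]
    simp only [← Fintype.sum_prod_type']
    let s : (ι × ι × ι × ι × ι × ι) ≃ (ι × ι × ι × ι × ι × ι) :=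
      ⟨fun (c, e, a, p, g, f) => (c, f, p, e, a, g), fun (c, f, p, e, a, g) => (c, e, a, p, g, f),
        fun _ => rfl, fun _ => rfl⟩
    refine Fintype.sum_equiv s _ _ ?_
    rintro ⟨c, e, a, p, g, f⟩
    simp only [s, Equiv.coe_fn_mk]
    rw [hH.apply f a, (hD c).apply f p, (hD g).apply a e]
    ring
  rw [key, contract_sub_left, contract_add_left]
  simp only [contract_sub_right hH, contract_add_right hH, contract_deriv₂₂, contract_deriv₃₃,
    contract_deriv₁₃ hD, contract_deriv₂₃ hD, contract_comm hH (derivTensor₂ D) (derivTensor₁ D),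
    contract_comm hH (derivTensor₃ D) (derivTensor₁ D),
    contract_comm hH (derivTensor₃ D) (derivTensor₂ D)]
  ring

theorem sum_deriv_inv_mul_christoffelAlg (hH : H.IsSymm) (hD : ∀ a, (D a).IsSymm) :
    ∑ a, ∑ c, ∑ e, (H * D a * H) c e * christoffelAlg H D a c e =
      contract H (derivTensor₁ D) (derivTensor₂ D)
        - (1 / 2) * contract H (derivTensor₁ D) (derivTensor₁ D) := by
  have key : ∑ a, ∑ c, ∑ e, (H * D a * H) c e * christoffelAlg H D a c e =
      (1 / 2) * contract H (derivTensor₁ D)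
        (derivTensor₂ D + derivTensor₃ D - derivTensor₁ D) := by
    simp only [contract_eq_sum, christoffelAlg, Matrix.mul_apply, Finset.mul_sum, Finset.sum_mul,
      Pi.add_apply, Pi.sub_apply, derivTensor₁, derivTensor₂, derivTensor₃]
    simp only [← Fintype.sum_prod_type']
    let s : (ι × ι × ι × ι × ι × ι) ≃ (ι × ι × ι × ι × ι × ι) :=
      ⟨fun (a, c, e, f, y, x) => (a, x, y, f, c, e), fun (a, x, y, f, c, e) => (a, c, e, f, y, x),
        fun _ => rfl, fun _ => rfl⟩
    refine Fintype.sum_equiv s _ _ ?_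
    rintro ⟨a, c, e, f, y, x⟩
    simp only [s, Equiv.coe_fn_mk]
    rw [hH.apply x c, (hD c).apply e f, (hD e).apply c f]
    ring
  rw [key, contract_sub_right hH, contract_add_right hH, contract_deriv₁₃ hD]
  ring

end Contraction

/-! ### Calculus of partial derivatives and smoothness of matrix entries -/

section PartialDeriv

variable {ι E : Type*} [NormedAddCommGroup E] [NormedSpace ℝ E]
  {b : Module.Basis ι ℝ E} {U : Set E} {u : E}

theorem partialDeriv_mul {h k : E → ℝ} (a : ι) (hh : DifferentiableAt ℝ h u)
    (hk : DifferentiableAt ℝ k u) :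
    partialDeriv b a (fun v => h v * k v) u =
      h u * partialDeriv b a k u + partialDeriv b a h u * k u := by
  simp only [partialDeriv, fderiv_fun_mul hh hk]
  simp [mul_comm]

theorem partialDeriv_sum {κ : Type*} {s : Finset κ} {h : κ → E → ℝ} (a : ι)
    (hh : ∀ i ∈ s, DifferentiableAt ℝ (h i) u) :
    partialDeriv b a (fun v => ∑ i ∈ s, h i v) u = ∑ i ∈ s, partialDeriv b a (h i) u := by
  simp only [partialDeriv, fderiv_fun_sum hh]
  simp

theorem partialDeriv_congr {h k : E → ℝ} (a : ι) (hU : IsOpen U) (hu : u ∈ U)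
    (hk : Set.EqOn h k U) : partialDeriv b a h u = partialDeriv b a k u := by
  rw [partialDeriv, partialDeriv,
    (hk.eventuallyEq_of_mem (hU.mem_nhds hu)).fderiv_eq]

theorem contDiffOn_partialDeriv {h : E → ℝ} (a : ι) (hU : IsOpen U) (hh : ContDiffOn ℝ ∞ h U) :
    ContDiffOn ℝ ∞ (partialDeriv b a h) U :=
  (hh.fderiv_of_isOpen hU le_rfl).clm_apply contDiffOn_const

theorem differentiableAt_of_contDiffOn {h : E → ℝ} (hU : IsOpen U) (hu : u ∈ U)
    (hh : ContDiffOn ℝ ∞ h U) : DifferentiableAt ℝ h u :=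
  (hh.contDiffAt (hU.mem_nhds hu)).differentiableAt (by simp)

theorem contDiffOn_det {κ : Type*} [Fintype κ] [DecidableEq κ] {G : E → Matrix κ κ ℝ}
    (hG : ∀ a c, ContDiffOn ℝ ∞ (fun v => G v a c) U) :
    ContDiffOn ℝ ∞ (fun v => (G v).det) U := by
  simp only [Matrix.det_apply]
  exact ContDiffOn.sum fun τ _ => (contDiffOn_prod fun i _ => hG _ _).const_smul _

theorem contDiffOn_inv_apply {κ : Type*} [Fintype κ] [DecidableEq κ] {G : E → Matrix κ κ ℝ}
    (hG : ∀ a c, ContDiffOn ℝ ∞ (fun v => G v a c) U) (hdet : ∀ v ∈ U, (G v).det ≠ 0) (a c : κ) :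
    ContDiffOn ℝ ∞ (fun v => (G v)⁻¹ a c) U := by
  simp only [Matrix.inv_def, Matrix.smul_apply, smul_eq_mul, Ring.inverse_eq_inv',
    Matrix.adjugate_apply]
  refine ((contDiffOn_det hG).inv hdet).mul (contDiffOn_det fun i j => ?_)
  -- The adjugate entry is the determinant of `G v` with row `c` replaced by a constant basis
  -- vector.
  by_cases h : i = c
  · subst h
    simpa using contDiffOn_const
  · simpa [Matrix.updateRow_ne h] using hG i j

theorem contDiffOn_mul_apply {κ : Type*} [Fintype κ] {A B : E → Matrix κ κ ℝ}
    (hA : ∀ a c, ContDiffOn ℝ ∞ (fun v => A v a c) U)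
    (hB : ∀ a c, ContDiffOn ℝ ∞ (fun v => B v a c) U) (a c : κ) :
    ContDiffOn ℝ ∞ (fun v => (A v * B v) a c) U := by
  simp only [Matrix.mul_apply]
  exact ContDiffOn.sum fun i _ => (hA a i).mul (hB i c)

end PartialDeriv

/-! ### Scalar curvature through logarithmic derivatives of the metric -/

section ScalarFormula

variable {ι E : Type*} [NormedAddCommGroup E] [NormedSpace ℝ E]
  (b : Module.Basis ι ℝ E) (G : E → Matrix ι ι ℝ)

/-- The matrix `(∂_a g_ce)` of partial derivatives of the metric. -/
def metricDeriv (a : ι) (u : E) : Matrix ι ι ℝ :=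
  Matrix.of fun c e => partialDeriv b a (fun v => G v c e) u

variable {b G} {U : Set E} {u : E}

theorem metricDeriv_isSymm (hU : IsOpen U) (hu : u ∈ U) (hs : ∀ v ∈ U, (G v).IsSymm) (a : ι) :
    (metricDeriv b G a u).IsSymm := by
  ext c e
  exact partialDeriv_congr a hU hu fun v hv => (hs v hv).apply _ _

theorem contDiffOn_metricDeriv (hU : IsOpen U) (hG : ∀ a c, ContDiffOn ℝ ∞ (fun v => G v a c) U)
    (a c e : ι) : ContDiffOn ℝ ∞ (fun v => metricDeriv b G a v c e) U :=
  contDiffOn_partialDeriv a hU (hG c e)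

variable [Fintype ι] [DecidableEq ι] (b G)

/-- The logarithmic derivative `g⁻¹ ∂_a g` of the metric. -/
def logDerivMetric (a : ι) (u : E) : Matrix ι ι ℝ :=
  (G u)⁻¹ * metricDeriv b G a u

/-- The contraction `∑ a, Γ^a_{ae}`. -/
def christoffelTrace (e : ι) (u : E) : ℝ :=
  (1 / 2) * (logDerivMetric b G e u).trace

/-- The contraction `∑ c e, g^{ce} Γ^d_{ce}`. -/
def christoffelVec (d : ι) (u : E) : ℝ :=
  ∑ a, ∑ c, logDerivMetric b G a u d c * (G u)⁻¹ c a
    - ∑ e, (G u)⁻¹ d e * christoffelTrace b G e u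

variable {b G}

theorem christoffel_eq_alg (d a c : ι) (u : E) :
    christoffel b G d a c u =
      christoffelAlg (G u)⁻¹ (fun i => metricDeriv b G i u) d a c := rfl

theorem contDiffOn_logDerivMetric (hU : IsOpen U)
    (hG : ∀ a c, ContDiffOn ℝ ∞ (fun v => G v a c) U) (hdet : ∀ v ∈ U, (G v).det ≠ 0) (a c e : ι) :
    ContDiffOn ℝ ∞ (fun v => logDerivMetric b G a v c e) U :=
  contDiffOn_mul_apply (contDiffOn_inv_apply hG hdet) (contDiffOn_metricDeriv hU hG a) c e

theorem contDiffOn_christoffel (hU : IsOpen U)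
    (hG : ∀ a c, ContDiffOn ℝ ∞ (fun v => G v a c) U) (hdet : ∀ v ∈ U, (G v).det ≠ 0) (d a c : ι) :
    ContDiffOn ℝ ∞ (christoffel b G d a c) U :=
  contDiffOn_const.mul <| ContDiffOn.sum fun e _ => (contDiffOn_inv_apply hG hdet d e).mul <|
    ((contDiffOn_partialDeriv a hU (hG c e)).add (contDiffOn_partialDeriv c hU (hG a e))).sub
      (contDiffOn_partialDeriv e hU (hG a c))

/-- Differentiate `G⁻¹ * G = 1`. -/
theorem partialDeriv_inv (hU : IsOpen U) (hu : u ∈ U)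
    (hG : ∀ a c, ContDiffOn ℝ ∞ (fun v => G v a c) U) (hdet : ∀ v ∈ U, (G v).det ≠ 0) (a c e : ι) :
    partialDeriv b a (fun v => (G v)⁻¹ c e) u =
      -((G u)⁻¹ * metricDeriv b G a u * (G u)⁻¹) c e := by
  let K : Matrix ι ι ℝ := Matrix.of fun c e => partialDeriv b a (fun v => (G v)⁻¹ c e) u
  have hd : ∀ c e, DifferentiableAt ℝ (fun v => G v c e) u := fun c e =>
    differentiableAt_of_contDiffOn hU hu (hG c e)
  have hd' : ∀ c e, DifferentiableAt ℝ (fun v => (G v)⁻¹ c e) u := fun c e =>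
    differentiableAt_of_contDiffOn hU hu (contDiffOn_inv_apply hG hdet c e)
  have h1 : (G u)⁻¹ * metricDeriv b G a u + K * G u = 0 := by
    ext c e
    have h2 : partialDeriv b a (fun v => ∑ p, (G v)⁻¹ c p * G v p e) u = 0 := by
      rw [partialDeriv_congr (k := fun _ => (1 : Matrix ι ι ℝ) c e) a hU hu fun v hv => ?_]
      · simp [partialDeriv]
      · simp only
        rw [← Matrix.mul_apply, Matrix.nonsing_inv_mul _ (hdet v hv).isUnit]
    rw [partialDeriv_sum a fun i _ => (hd' c i).fun_mul (hd i e)] at h2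
    simp only [partialDeriv_mul a (hd' _ _) (hd _ _), Finset.sum_add_distrib] at h2
    simpa [Matrix.mul_apply, metricDeriv, K] using h2
  have h3 : K = -((G u)⁻¹ * metricDeriv b G a u * (G u)⁻¹) := by
    rw [eq_neg_of_add_eq_zero_left h1, neg_mul, neg_neg, Matrix.mul_assoc,
      Matrix.mul_nonsing_inv _ (hdet u hu).isUnit, Matrix.mul_one]
  exact congrFun (congrFun h3 c) e

/-- Pulling `∂_a` out of `g^{ce} ∂_a Γ^a_{ce}` leaves the divergence of `christoffelVec` and a
correction from `∂_a G⁻¹`. That correction and the quadratic term `Γ Γ` are both combinations of the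
two basic contractions, and combine to the coefficients `-1/4` and `1/2`. In this form each term
respects a block decomposition. -/
theorem scalarCoord_eq (hU : IsOpen U) (hu : u ∈ U)
    (hG : ∀ a c, ContDiffOn ℝ ∞ (fun v => G v a c) U) (hdet : ∀ v ∈ U, (G v).det ≠ 0)
    (hs : ∀ v ∈ U, (G v).IsSymm) :
    scalarCoord b G u =
      ∑ d, partialDeriv b d (christoffelVec b G d) u
      - ∑ c, ∑ e, (G u)⁻¹ c e * partialDeriv b c (christoffelTrace b G e) u
      + ∑ p, christoffelTrace b G p u * christoffelVec b G p u
      - (1 / 4) * ∑ p, ∑ e, (G u)⁻¹ p e * (logDerivMetric b G p u * logDerivMetric b G e u).trace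
      + (1 / 2) * ∑ a, ∑ c, ∑ p, ∑ e,
          logDerivMetric b G a u c p * (G u)⁻¹ p e * logDerivMetric b G c u a e := by
  have hH : ∀ v ∈ U, ((G v)⁻¹).IsSymm := fun v hv => (hs v hv).inv
  have hD : ∀ v ∈ U, ∀ a, (metricDeriv b G a v).IsSymm := fun v hv a =>
    metricDeriv_isSymm hU hv hs a
  have hT : ∀ v ∈ U, ∀ e, ∑ a, christoffel b G a a e v = christoffelTrace b G e v :=
    fun v hv e => sum_christoffelAlg_self (hH v hv) (hD v hv) e
  have hV : ∀ v ∈ U, ∀ d, ∑ c, ∑ e, (G v)⁻¹ c e * christoffel b G d c e v =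
      christoffelVec b G d v :=
    fun v hv d => sum_inv_mul_christoffelAlg (hH v hv) (hD v hv) d
  have dΓ : ∀ d a c, DifferentiableAt ℝ (christoffel b G d a c) u := fun d a c =>
    differentiableAt_of_contDiffOn hU hu (contDiffOn_christoffel hU hG hdet d a c)
  have dH : ∀ c e, DifferentiableAt ℝ (fun v => (G v)⁻¹ c e) u := fun c e =>
    differentiableAt_of_contDiffOn hU hu (contDiffOn_inv_apply hG hdet c e)
  have hdT : ∀ c e, ∑ a, partialDeriv b c (christoffel b G a a e) u =
      partialDeriv b c (christoffelTrace b G e) u := fun c e => by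
    rw [← partialDeriv_sum c fun i _ => dΓ _ _ _]
    exact partialDeriv_congr c hU hu fun v hv => hT v hv e
  have hdV : ∀ a, ∑ c, ∑ e, (G u)⁻¹ c e * partialDeriv b a (christoffel b G a c e) u =
      partialDeriv b a (christoffelVec b G a) u + ∑ c, ∑ e,
        ((G u)⁻¹ * metricDeriv b G a u * (G u)⁻¹) c e * christoffel b G a c e u := fun a => by
    rw [← partialDeriv_congr (h := fun v => ∑ c, ∑ e, (G v)⁻¹ c e * christoffel b G a c e v) a hU hu
      fun v hv => hV v hv a, partialDeriv_sum a fun i _ =>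
        DifferentiableAt.fun_sum fun j _ => (dH _ _).fun_mul (dΓ _ _ _)]
    rw [← Finset.sum_add_distrib]
    refine Finset.sum_congr rfl fun c _ => ?_
    rw [partialDeriv_sum a fun i _ => (dH _ _).fun_mul (dΓ _ _ _), ← Finset.sum_add_distrib]
    refine Finset.sum_congr rfl fun e _ => ?_
    rw [partialDeriv_mul a (dH _ _) (dΓ _ _ _), partialDeriv_inv hU hu hG hdet]
    ring
  have e1 : ∑ c, ∑ e, (G u)⁻¹ c e * ∑ a, partialDeriv b a (christoffel b G a c e) u =
      ∑ d, partialDeriv b d (christoffelVec b G d) u +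
        ∑ a, ∑ c, ∑ e, ((G u)⁻¹ * metricDeriv b G a u * (G u)⁻¹) c e *
          christoffel b G a c e u := by
    rw [← Finset.sum_add_distrib, ← Finset.sum_congr rfl fun a _ => hdV a]
    simp only [Finset.mul_sum]
    rw [Finset.sum_congr rfl fun c _ => Finset.sum_comm, Finset.sum_comm]
  have e2 : ∑ c, ∑ e, (G u)⁻¹ c e * ∑ a, ∑ p,
      christoffel b G a a p u * christoffel b G p c e u =
        ∑ p, christoffelTrace b G p u * christoffelVec b G p u := by
    simp only [← hT u hu, ← hV u hu, Finset.mul_sum, Finset.sum_mul]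
    simp only [← Fintype.sum_prod_type']
    let s : (ι × ι × ι × ι) ≃ (ι × ι × ι × ι) :=
      ⟨fun (c, e, a, p) => (p, c, e, a), fun (p, c, e, a) => (c, e, a, p),
        fun _ => rfl, fun _ => rfl⟩
    refine Fintype.sum_equiv s _ _ ?_
    rintro ⟨c, e, a, p⟩
    simp only [s, Equiv.coe_fn_mk]
    ring
  have e3 := sum_deriv_inv_mul_christoffelAlg (hH u hu) (hD u hu)
  have e4 := sum_inv_mul_christoffelAlg_mul (hH u hu) (hD u hu)
  have e5 : ∑ p, ∑ e, (G u)⁻¹ p e *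
      (logDerivMetric b G p u * logDerivMetric b G e u).trace = _ :=
    sum_inv_mul_trace_eq_contract (hH u hu) (hD u hu)
  have e6 : ∑ a, ∑ c, ∑ p, ∑ e,
      logDerivMetric b G a u c p * (G u)⁻¹ p e * logDerivMetric b G c u a e = _ :=
    sum_mul_inv_mul_eq_contract (hH u hu) (D := fun a => metricDeriv b G a u)
  simp only [← christoffel_eq_alg] at e3 e4
  rw [e5, e6]
  simp only [scalarCoord, ricciCoord, riemannCoord, Finset.sum_add_distrib, Finset.sum_sub_distrib,
    mul_add, mul_sub, e1, e2, e3, hdT]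
  simp only [← Finset.mul_sum] at e4
  rw [e4]
  ring

end ScalarFormula

/-! ### Sums over block indices -/

section BlockSums

variable {κ : Type*} [Fintype κ] {ν : κ → Type*} [∀ i, Fintype (ν i)]

theorem sum_sigma_eq_sum_block (k : κ) (f : (Σ i, ν i) → ℝ)
    (hf : ∀ x : Σ i, ν i, x.1 ≠ k → f x = 0) : ∑ x, f x = ∑ c, f ⟨k, c⟩ := by
  classical
  rw [Fintype.sum_sigma]
  exact Finset.sum_eq_single k (fun i _ hi => Finset.sum_eq_zero fun c _ => hf ⟨i, c⟩ hi)
    (fun h => absurd (Finset.mem_univ k) h)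

theorem sum_blockDiagonal'_mul [DecidableEq κ] (M : ∀ i, Matrix (ν i) (ν i) ℝ)
    (f : (Σ i, ν i) → (Σ i, ν i) → ℝ) :
    ∑ x, ∑ y, Matrix.blockDiagonal' M x y * f x y =
      ∑ k, ∑ c, ∑ e, M k c e * f ⟨k, c⟩ ⟨k, e⟩ := by
  rw [Fintype.sum_sigma]
  refine Finset.sum_congr rfl fun k _ => Finset.sum_congr rfl fun c _ => ?_
  rw [sum_sigma_eq_sum_block k]
  · simp only [Matrix.blockDiagonal'_apply_eq]
  · rintro ⟨i, e⟩ hi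
    rw [Matrix.blockDiagonal'_apply_ne M c e (Ne.symm hi), zero_mul]

end BlockSums

/-! ### The contribution of a single factor -/

section BlockScalar

variable {ν E : Type*} [Fintype ν] [DecidableEq ν] [NormedAddCommGroup E] [NormedSpace ℝ E]
  (β : Module.Basis ν ℝ E) (h : E → Matrix ν ν ℝ) (φ : E → ℝ) (n : ℝ)

/-- The logarithmic derivative of a function. -/
def logPartialDeriv (e : ν) (y : E) : ℝ := (φ y)⁻¹ * partialDeriv β e φ y

/-- The trace of the Christoffel symbols in the directions of a factor with metric `h`, when `φ`
scales a factor of dimension `n`. -/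
def blockTrace (e : ν) (y : E) : ℝ :=
  (1 / 2) * ((logDerivMetric β h e y).trace + n * logPartialDeriv β φ e y)

/-- The components of `∑ g^{ce} Γ^d_{ce}` in the directions of a factor with metric `h`, up to the
conformal factor. -/
def blockVec (d : ν) (y : E) : ℝ :=
  ∑ a, ∑ c, logDerivMetric β h a y d c * (h y)⁻¹ c a
    - ∑ e, (h y)⁻¹ d e * blockTrace β h φ n e y

/-- The contribution to the scalar curvature of a factor with metric `h`, up to the conformal
factor, when `φ` scales a factor of dimension `n`. -/
def blockScalar (y : E) : ℝ :=
  ∑ d, partialDeriv β d (blockVec β h φ n d) y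
    - ∑ c, ∑ e, (h y)⁻¹ c e * partialDeriv β c (blockTrace β h φ n e) y
    + ∑ p, blockTrace β h φ n p y * blockVec β h φ n p y
    - (1 / 4) * ∑ p, ∑ e, (h y)⁻¹ p e * ((logDerivMetric β h p y * logDerivMetric β h e y).trace
        + n * (logPartialDeriv β φ p y * logPartialDeriv β φ e y))
    + (1 / 2) * ∑ a, ∑ c, ∑ p, ∑ e,
        logDerivMetric β h a y c p * (h y)⁻¹ p e * logDerivMetric β h c y a e

variable {β h φ n} {U : Set E}

theorem contDiffOn_blockTrace (hU : IsOpen U) (hh : ∀ a c, ContDiffOn ℝ ∞ (fun y => h y a c) U)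
    (hdet : ∀ y ∈ U, (h y).det ≠ 0) (hφ : ContDiffOn ℝ ∞ φ U) (hφ0 : ∀ y ∈ U, φ y ≠ 0) (e : ν) :
    ContDiffOn ℝ ∞ (blockTrace β h φ n e) U := by
  refine contDiffOn_const.mul (ContDiffOn.add ?_ (contDiffOn_const.mul ?_))
  · exact ContDiffOn.sum fun i _ => contDiffOn_logDerivMetric hU hh hdet e i i
  · exact (hφ.inv hφ0).mul (contDiffOn_partialDeriv e hU hφ)

theorem contDiffOn_blockVec (hU : IsOpen U) (hh : ∀ a c, ContDiffOn ℝ ∞ (fun y => h y a c) U)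
    (hdet : ∀ y ∈ U, (h y).det ≠ 0) (hφ : ContDiffOn ℝ ∞ φ U) (hφ0 : ∀ y ∈ U, φ y ≠ 0) (d : ν) :
    ContDiffOn ℝ ∞ (blockVec β h φ n d) U := by
  refine ContDiffOn.sub (ContDiffOn.sum fun a _ => ContDiffOn.sum fun c _ => ?_)
    (ContDiffOn.sum fun e _ => ?_)
  · exact (contDiffOn_logDerivMetric hU hh hdet a d c).mul (contDiffOn_inv_apply hh hdet c a)
  · exact (contDiffOn_inv_apply hh hdet d e).mul (contDiffOn_blockTrace hU hh hdet hφ hφ0 e)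

end BlockScalar

/-! ### Derivatives of a block diagonal metric -/

section Product

variable {κ : Type*} [Fintype κ] [DecidableEq κ] {E : κ → Type*} [∀ i, NormedAddCommGroup (E i)]
  {ν : κ → Type*} [∀ i, Fintype (ν i)] [∀ i, DecidableEq (ν i)] {U : ∀ i, Set (E i)}
  {h : ∀ i, E i → Matrix (ν i) (ν i) ℝ} {φ : ∀ i, E i → ℝ} {σ : Equiv.Perm κ}
  {G : (∀ i, E i) → Matrix (Σ i, ν i) (Σ i, ν i) ℝ} {u : ∀ i, E i}

theorem inv_blockDiagonal'_smul
    (hdet : ∀ i, ∀ y ∈ U i, (h i y).det ≠ 0) (hφ0 : ∀ i, ∀ y ∈ U i, φ i y ≠ 0)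
    (hG : ∀ v ∈ Set.univ.pi U,
      G v = Matrix.blockDiagonal' fun i => φ (σ i) (v (σ i)) • h i (v i))
    (hu : u ∈ Set.univ.pi U) :
    Matrix.blockDiagonal' (fun i => (φ (σ i) (u (σ i)))⁻¹ • (h i (u i))⁻¹) * G u = 1 := by
  rw [hG u hu, ← Matrix.blockDiagonal'_mul, ← Matrix.blockDiagonal'_one]
  congr 1
  funext i
  rw [Matrix.smul_mul, Matrix.mul_smul, smul_smul, inv_mul_cancel₀ (hφ0 _ _ (hu _ trivial)),
    one_smul, Matrix.nonsing_inv_mul _ (hdet i _ (hu i trivial)).isUnit]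
  rfl

variable [∀ i, NormedSpace ℝ (E i)] {β : ∀ i, Module.Basis (ν i) ℝ (E i)}

theorem partialDeriv_pi_same {k : κ} (c : ν k) {f : E k → ℝ}
    (hf : DifferentiableAt ℝ f (u k)) :
    partialDeriv (Pi.basis β) ⟨k, c⟩ (fun v => f (v k)) u = partialDeriv (β k) c f (u k) := by
  have h1 : HasFDerivAt (fun v : ∀ i, E i => f (v k))
      ((fderiv ℝ f (u k)).comp (ContinuousLinearMap.proj k)) u :=
    HasFDerivAt.comp u hf.hasFDerivAt (hasFDerivAt_apply k u)
  simp [partialDeriv, h1.fderiv]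

theorem partialDeriv_pi_ne {i k : κ} (hik : i ≠ k) (c : ν k) {f : E i → ℝ}
     (hf : DifferentiableAt ℝ f (u i)) :
    partialDeriv (Pi.basis β) ⟨k, c⟩ (fun v => f (v i)) u = 0 := by
  have h1 : HasFDerivAt (fun v : ∀ i, E i => f (v i))
      ((fderiv ℝ f (u i)).comp (ContinuousLinearMap.proj i)) u :=
    HasFDerivAt.comp u hf.hasFDerivAt (hasFDerivAt_apply i u)
  simp [partialDeriv, h1.fderiv, hik]

/-- The coordinate in factor `k` enters block `k` through `h k`, and block `σ⁻¹ k` through its scale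
`φ k`. These blocks differ because `σ` has no fixed point. -/
theorem metricDeriv_blockDiagonal' (hσ : ∀ i, σ i ≠ i) (hU : ∀ i, IsOpen (U i))
    (hh : ∀ i a c, ContDiffOn ℝ ∞ (fun y => h i y a c) (U i))
    (hφ : ∀ i, ContDiffOn ℝ ∞ (φ i) (U i))
    (hG : ∀ v ∈ Set.univ.pi U,
      G v = Matrix.blockDiagonal' fun i => φ (σ i) (v (σ i)) • h i (v i))
    (hu : u ∈ Set.univ.pi U) (k : κ) (c : ν k) :
    metricDeriv (Pi.basis β) G ⟨k, c⟩ u = Matrix.blockDiagonal'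
      ((Pi.single k (φ (σ k) (u (σ k)) • metricDeriv (β k) (h k) c (u k)) :
        ∀ i, Matrix (ν i) (ν i) ℝ) +
        Pi.single (σ.symm k) (partialDeriv (β k) c (φ k) (u k) • h (σ.symm k) (u (σ.symm k)))) := by
  have hUo : IsOpen (Set.univ.pi U) := isOpen_set_pi Set.finite_univ fun i _ => hU i
  have dφ : ∀ i, DifferentiableAt ℝ (φ i) (u i) := fun i =>
    differentiableAt_of_contDiffOn (hU i) (hu i trivial) (hφ i)
  have dh : ∀ i a e, DifferentiableAt ℝ (fun y => h i y a e) (u i) := fun i a e =>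
    differentiableAt_of_contDiffOn (hU i) (hu i trivial) (hh i a e)
  have dφ' : ∀ i, DifferentiableAt ℝ (fun v : ∀ i, E i => φ i (v i)) u := fun i =>
    DifferentiableAt.fun_comp' u (dφ i) (differentiableAt_apply i u)
  have dh' : ∀ i a e, DifferentiableAt ℝ (fun v : ∀ i, E i => h i (v i) a e) u := fun i a e =>
    DifferentiableAt.fun_comp' u (g := fun y => h i y a e) (dh i a e) (differentiableAt_apply i u)
  ext ⟨i, a⟩ ⟨j, e⟩
  rw [metricDeriv, Matrix.of_apply]
  by_cases hij : i = j
  · subst hij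
    rw [partialDeriv_congr (k := fun v => φ (σ i) (v (σ i)) * h i (v i) a e) _ hUo hu fun v hv => by
      simp [hG v hv], Matrix.blockDiagonal'_apply_eq, partialDeriv_mul _ (dφ' _) (dh' _ _ _)]
    by_cases hik : i = k
    · subst hik
      have : i ≠ σ.symm i := fun h => hσ i (by rw [h]; simpa using h)
      rw [partialDeriv_pi_ne (hσ i) c (dφ _),
        partialDeriv_pi_same (f := fun y => h i y a e) c (dh _ _ _)]
      simp [Pi.single_eq_of_ne this, metricDeriv]
    · rw [partialDeriv_pi_ne (f := fun y => h i y a e) hik c (dh _ _ _)]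
      by_cases hik' : σ i = k
      · subst hik'
        -- Stated for a free index `j`, since the matrix type depends on it and `σ.symm (σ i)`
        -- cannot be rewritten to `i` in place.
        have h1 : ∀ (r : ℝ) (j : κ), j = i →
            (Pi.single j (r • h j (u j)) : ∀ i, Matrix (ν i) (ν i) ℝ) i a e =
              r * h i (u i) a e := by
          rintro r _ rfl
          simp
        rw [partialDeriv_pi_same c (dφ _), Pi.add_apply, Matrix.add_apply,
          h1 _ _ (σ.symm_apply_apply i)]
        simp [Pi.single_eq_of_ne hik]
      · have : i ≠ σ.symm k := fun h => hik' (by rw [h]; simp)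
        rw [partialDeriv_pi_ne hik' c (dφ _)]
        simp [Pi.single_eq_of_ne hik, Pi.single_eq_of_ne this]
  · rw [partialDeriv_congr (k := fun v => 0) _ hUo hu fun v hv => by
      simp [hG v hv, Matrix.blockDiagonal'_apply_ne _ a e hij],
      Matrix.blockDiagonal'_apply_ne _ a e hij]
    simp [partialDeriv]

/-- In block `k` the scale cancels against its inverse; in block `σ⁻¹ k` the matrix `h` does. So the
result depends on `u k` only. -/
theorem logDerivMetric_blockDiagonal' (hσ : ∀ i, σ i ≠ i) (hU : ∀ i, IsOpen (U i))
    (hh : ∀ i a c, ContDiffOn ℝ ∞ (fun y => h i y a c) (U i))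
    (hdet : ∀ i, ∀ y ∈ U i, (h i y).det ≠ 0)
    (hφ : ∀ i, ContDiffOn ℝ ∞ (φ i) (U i)) (hφ0 : ∀ i, ∀ y ∈ U i, φ i y ≠ 0)
    (hG : ∀ v ∈ Set.univ.pi U,
      G v = Matrix.blockDiagonal' fun i => φ (σ i) (v (σ i)) • h i (v i))
    (hu : u ∈ Set.univ.pi U) (k : κ) (c : ν k) :
    logDerivMetric (Pi.basis β) G ⟨k, c⟩ u = Matrix.blockDiagonal'
      ((Pi.single k (logDerivMetric (β k) (h k) c (u k)) : ∀ i, Matrix (ν i) (ν i) ℝ) +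
        Pi.single (σ.symm k) (logPartialDeriv (β k) (φ k) c (u k) • 1)) := by
  rw [logDerivMetric, Matrix.inv_eq_left_inv (inv_blockDiagonal'_smul hdet hφ0 hG hu),
    metricDeriv_blockDiagonal' hσ hU hh hφ hG hu, ← Matrix.blockDiagonal'_mul]
  congr 1
  funext i
  have hk : k ≠ σ.symm k := fun h => hσ k (by rw [h]; simpa using h)
  by_cases hik : i = k
  · subst hik
    simp only [Pi.add_apply, Pi.single_eq_same, Pi.single_eq_of_ne hk, add_zero]
    rw [Matrix.smul_mul, Matrix.mul_smul, smul_smul, inv_mul_cancel₀ (hφ0 _ _ (hu _ trivial)),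
      one_smul, logDerivMetric]
  · simp only [Pi.add_apply, Pi.single_eq_of_ne hik, zero_add]
    by_cases hik' : i = σ.symm k
    · subst hik'
      simp only [Pi.single_eq_same, Matrix.smul_mul, Matrix.mul_smul, smul_smul]
      rw [Matrix.nonsing_inv_mul _ (hdet _ _ (hu _ trivial)).isUnit, logPartialDeriv,
        σ.apply_symm_apply, mul_comm]
    · simp only [Pi.single_eq_of_ne hik', Matrix.mul_zero]

theorem trace_blockDiagonal'_single {k j : κ} (A : Matrix (ν k) (ν k) ℝ) (s : ℝ) :
    (Matrix.blockDiagonal' ((Pi.single k A : ∀ i, Matrix (ν i) (ν i) ℝ) +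
      Pi.single j (s • 1))).trace = A.trace + Fintype.card (ν j) * s := by
  rw [Matrix.blockDiagonal'_add, Matrix.trace_add, Matrix.trace_blockDiagonal',
    Matrix.trace_blockDiagonal', Finset.sum_eq_single k, Finset.sum_eq_single j]
  · simp [mul_comm]
  · intro i _ hi
    simp [Pi.single_eq_of_ne hi]
  · simp
  · intro i _ hi
    simp [Pi.single_eq_of_ne hi]
  · simp

/-- As `k ≠ j`, there are no cross terms, and the scalar blocks contribute through the trace of the
identity, the size of block `j`. -/
theorem trace_blockDiagonal'_single_mul {k j : κ} (hkj : k ≠ j) (A B : Matrix (ν k) (ν k) ℝ)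
    (s t : ℝ) :
    (Matrix.blockDiagonal' ((Pi.single k A : ∀ i, Matrix (ν i) (ν i) ℝ) + Pi.single j (s • 1)) *
      Matrix.blockDiagonal' ((Pi.single k B : ∀ i, Matrix (ν i) (ν i) ℝ) +
        Pi.single j (t • 1))).trace = (A * B).trace + Fintype.card (ν j) * (s * t) := by
  rw [← Matrix.blockDiagonal'_mul, ← trace_blockDiagonal'_single]
  congr 2
  funext i
  by_cases hik : i = k
  · subst hik
    simp [Pi.single_eq_of_ne hkj]
  · by_cases hij : i = j
    · subst hij
      simp [Pi.single_eq_of_ne hik, smul_smul, mul_comm]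
    · simp [Pi.single_eq_of_ne hik, Pi.single_eq_of_ne hij]

end Product

/-! ### Separation of variables in the scalar curvature of a twisted product -/

section ProductScalar

variable {κ : Type*} [Fintype κ] [DecidableEq κ] {E : κ → Type*} [∀ i, NormedAddCommGroup (E i)]
  [∀ i, NormedSpace ℝ (E i)] {ν : κ → Type*} [∀ i, Fintype (ν i)] [∀ i, DecidableEq (ν i)]
  {U : ∀ i, Set (E i)} {h : ∀ i, E i → Matrix (ν i) (ν i) ℝ} {φ : ∀ i, E i → ℝ}
  {σ : Equiv.Perm κ} {G : (∀ i, E i) → Matrix (Σ i, ν i) (Σ i, ν i) ℝ} {u : ∀ i, E i}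
  {β : ∀ i, Module.Basis (ν i) ℝ (E i)}

theorem contDiffOn_comp_apply {i : κ} {f : E i → ℝ} (hf : ContDiffOn ℝ ∞ f (U i)) :
    ContDiffOn ℝ ∞ (fun v : ∀ i, E i => f (v i)) (Set.univ.pi U) :=
  hf.comp (ContinuousLinearMap.proj (R := ℝ) (φ := E) i).contDiff.contDiffOn
    fun _ hv => hv i trivial

theorem contDiffOn_blockDiagonal'_apply
    (hh : ∀ i a c, ContDiffOn ℝ ∞ (fun y => h i y a c) (U i))
    (hφ : ∀ i, ContDiffOn ℝ ∞ (φ i) (U i))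
    (hG : ∀ v ∈ Set.univ.pi U,
      G v = Matrix.blockDiagonal' fun i => φ (σ i) (v (σ i)) • h i (v i)) (x y : Σ i, ν i) :
    ContDiffOn ℝ ∞ (fun v => G v x y) (Set.univ.pi U) := by
  obtain ⟨i, a⟩ := x
  obtain ⟨j, c⟩ := y
  by_cases hij : i = j
  · subst hij
    refine ContDiffOn.congr (f := fun v => φ (σ i) (v (σ i)) * h i (v i) a c)
      ((contDiffOn_comp_apply (hφ _)).mul
        (contDiffOn_comp_apply (f := fun y => h i y a c) (hh i a c))) fun v hv => ?_
    simp [hG v hv]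
  · refine ContDiffOn.congr (f := fun v => 0) contDiffOn_const fun v hv => ?_
    rw [hG v hv, Matrix.blockDiagonal'_apply_ne _ a c hij]

variable (β) in
/-- Local data of a product of metrics `h i` scaled by functions `φ (σ i)` of a single factor. -/
structure IsTwistedProduct (U : ∀ i, Set (E i)) (h : ∀ i, E i → Matrix (ν i) (ν i) ℝ)
    (φ : ∀ i, E i → ℝ) (σ : Equiv.Perm κ) (G : (∀ i, E i) → Matrix (Σ i, ν i) (Σ i, ν i) ℝ) :
    Prop where
  ne : ∀ i, σ i ≠ i
  isOpen : ∀ i, IsOpen (U i)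
  smooth : ∀ i a c, ContDiffOn ℝ ∞ (fun y => h i y a c) (U i)
  det_ne : ∀ i, ∀ y ∈ U i, (h i y).det ≠ 0
  symm : ∀ i, ∀ y ∈ U i, (h i y).IsSymm
  smooth_scale : ∀ i, ContDiffOn ℝ ∞ (φ i) (U i)
  scale_ne : ∀ i, ∀ y ∈ U i, φ i y ≠ 0
  eq : ∀ v ∈ Set.univ.pi U, G v = Matrix.blockDiagonal' fun i => φ (σ i) (v (σ i)) • h i (v i)

namespace IsTwistedProduct

theorem inv_eq (hG : IsTwistedProduct U h φ σ G) (hu : u ∈ Set.univ.pi U) :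
    (G u)⁻¹ = Matrix.blockDiagonal' fun i => (φ (σ i) (u (σ i)))⁻¹ • (h i (u i))⁻¹ :=
  Matrix.inv_eq_left_inv (inv_blockDiagonal'_smul hG.det_ne hG.scale_ne hG.eq hu)

theorem logDeriv (hG : IsTwistedProduct U h φ σ G) (hu : u ∈ Set.univ.pi U) (k : κ) (c : ν k) :
    logDerivMetric (Pi.basis β) G ⟨k, c⟩ u = Matrix.blockDiagonal'
      ((Pi.single k (logDerivMetric (β k) (h k) c (u k)) : ∀ i, Matrix (ν i) (ν i) ℝ) +
        Pi.single (σ.symm k) (logPartialDeriv (β k) (φ k) c (u k) • 1)) :=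
  logDerivMetric_blockDiagonal' hG.ne hG.isOpen hG.smooth hG.det_ne hG.smooth_scale hG.scale_ne
    hG.eq hu k c

theorem ne_symm (hG : IsTwistedProduct U h φ σ G) (k : κ) : k ≠ σ.symm k :=
  fun h => hG.ne k (by rw [h]; simpa using h)

theorem logDeriv_apply_same (hG : IsTwistedProduct U h φ σ G) (hu : u ∈ Set.univ.pi U) {k : κ}
    (c a e : ν k) : logDerivMetric (Pi.basis β) G ⟨k, c⟩ u ⟨k, a⟩ ⟨k, e⟩ =
      logDerivMetric (β k) (h k) c (u k) a e := by
  rw [hG.logDeriv hu, Matrix.blockDiagonal'_apply_eq]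
  simp [Pi.single_eq_of_ne (hG.ne_symm k)]

theorem logDeriv_apply_ne (hG : IsTwistedProduct U h φ σ G) (hu : u ∈ Set.univ.pi U)
    (x : Σ i, ν i) {y z : Σ i, ν i} (hyz : y.1 ≠ z.1) :
    logDerivMetric (Pi.basis β) G x u y z = 0 := by
  obtain ⟨k, c⟩ := x
  rw [hG.logDeriv hu]
  exact Matrix.blockDiagonal'_apply_ne _ _ _ hyz

theorem trace_eq (hG : IsTwistedProduct U h φ σ G) (hu : u ∈ Set.univ.pi U) (k : κ) (e : ν k) :
    christoffelTrace (Pi.basis β) G ⟨k, e⟩ u =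
      blockTrace (β k) (h k) (φ k) (Fintype.card (ν (σ.symm k))) e (u k) := by
  rw [christoffelTrace, hG.logDeriv hu, trace_blockDiagonal'_single, blockTrace]

theorem vec_eq (hG : IsTwistedProduct U h φ σ G) (hu : u ∈ Set.univ.pi U) (k : κ) (d : ν k) :
    christoffelVec (Pi.basis β) G ⟨k, d⟩ u = (φ (σ k) (u (σ k)))⁻¹ *
      blockVec (β k) (h k) (φ k) (Fintype.card (ν (σ.symm k))) d (u k) := by
  rw [christoffelVec, blockVec, mul_sub, Finset.mul_sum, Finset.mul_sum]
  congr 1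
  · rw [Finset.sum_comm, sum_sigma_eq_sum_block k]
    · simp only [Finset.mul_sum]
      refine Eq.trans ?_ Finset.sum_comm
      refine Finset.sum_congr rfl fun c _ => ?_
      rw [sum_sigma_eq_sum_block k]
      · refine Finset.sum_congr rfl fun a _ => ?_
        rw [hG.logDeriv_apply_same hu, hG.inv_eq hu, Matrix.blockDiagonal'_apply_eq,
          Matrix.smul_apply, smul_eq_mul]
        ring
      · rintro ⟨i, a⟩ hi
        rw [hG.inv_eq hu, Matrix.blockDiagonal'_apply_ne _ c a (Ne.symm hi), mul_zero]
    · rintro ⟨i, c⟩ hi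
      refine Finset.sum_eq_zero fun a _ => ?_
      rw [hG.logDeriv_apply_ne hu a (Ne.symm hi), zero_mul]
  · rw [sum_sigma_eq_sum_block k]
    · refine Finset.sum_congr rfl fun e _ => ?_
      rw [hG.inv_eq hu, Matrix.blockDiagonal'_apply_eq, hG.trace_eq hu, Matrix.smul_apply,
        smul_eq_mul, mul_assoc]
    · rintro ⟨i, a⟩ hi
      rw [hG.inv_eq hu, Matrix.blockDiagonal'_apply_ne _ d a (Ne.symm hi), zero_mul]

/-- Each of the five terms of `scalarCoord_eq` splits over blocks, with one factor `G⁻¹` supplying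
the scale `(φ (σ k))⁻¹` and everything else depending on `u k`. -/
theorem scalarCoord_eq_sum (hG : IsTwistedProduct U h φ σ G) (hu : u ∈ Set.univ.pi U) :
    scalarCoord (Pi.basis β) G u = ∑ k, (φ (σ k) (u (σ k)))⁻¹ *
      blockScalar (β k) (h k) (φ k) (Fintype.card (ν (σ.symm k))) (u k) := by
  have hUo : IsOpen (Set.univ.pi U) := isOpen_set_pi Set.finite_univ fun i _ => hG.isOpen i
  have dT : ∀ k e, DifferentiableAt ℝ
      (blockTrace (β k) (h k) (φ k) (Fintype.card (ν (σ.symm k))) e) (u k) := fun k e =>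
    differentiableAt_of_contDiffOn (hG.isOpen k) (hu k trivial) <|
      contDiffOn_blockTrace (hG.isOpen k) (hG.smooth k) (hG.det_ne k) (hG.smooth_scale k)
        (hG.scale_ne k) e
  have dV : ∀ k d, DifferentiableAt ℝ
      (blockVec (β k) (h k) (φ k) (Fintype.card (ν (σ.symm k))) d) (u k) := fun k d =>
    differentiableAt_of_contDiffOn (hG.isOpen k) (hu k trivial) <|
      contDiffOn_blockVec (hG.isOpen k) (hG.smooth k) (hG.det_ne k) (hG.smooth_scale k)
        (hG.scale_ne k) d
  have dφ : ∀ k, DifferentiableAt ℝ (fun y => (φ k y)⁻¹) (u k) := fun k =>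
    differentiableAt_of_contDiffOn (hG.isOpen k) (hu k trivial) <|
      (hG.smooth_scale k).inv (hG.scale_ne k)
  have e1 : ∑ d, partialDeriv (Pi.basis β) d (christoffelVec (Pi.basis β) G d) u =
      ∑ k, ∑ d, (φ (σ k) (u (σ k)))⁻¹ * partialDeriv (β k) d
        (blockVec (β k) (h k) (φ k) (Fintype.card (ν (σ.symm k))) d) (u k) := by
    rw [Fintype.sum_sigma]
    refine Finset.sum_congr rfl fun k _ => Finset.sum_congr rfl fun d _ => ?_
    -- The scale `(φ (σ k))⁻¹` is constant in the directions of factor `k`, as `σ k ≠ k`.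
    rw [partialDeriv_congr _ hUo hu fun v hv => hG.vec_eq hv k d,
      partialDeriv_mul (h := fun v : ∀ i, E i => (φ (σ k) (v (σ k)))⁻¹),
      partialDeriv_pi_same _ (dV k d),
      partialDeriv_pi_ne (f := fun y => (φ (σ k) y)⁻¹) (hG.ne k) _ (dφ _)]
    · simp
    · exact DifferentiableAt.fun_comp' u (g := fun y => (φ (σ k) y)⁻¹) (dφ (σ k))
        (differentiableAt_apply _ u)
    · exact DifferentiableAt.fun_comp' u (dV k d) (differentiableAt_apply _ u)
  have e2 : ∑ c, ∑ e, (G u)⁻¹ c e *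
      partialDeriv (Pi.basis β) c (christoffelTrace (Pi.basis β) G e) u =
      ∑ k, ∑ c, ∑ e, (φ (σ k) (u (σ k)))⁻¹ * ((h k (u k))⁻¹ c e * partialDeriv (β k) c
        (blockTrace (β k) (h k) (φ k) (Fintype.card (ν (σ.symm k))) e) (u k)) := by
    rw [hG.inv_eq hu, sum_blockDiagonal'_mul]
    refine Finset.sum_congr rfl fun k _ => Finset.sum_congr rfl fun c _ =>
      Finset.sum_congr rfl fun e _ => ?_
    rw [partialDeriv_congr _ hUo hu fun v hv => hG.trace_eq hv k e,
      partialDeriv_pi_same _ (dT k e), Matrix.smul_apply, smul_eq_mul, mul_assoc]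
  have e3 : ∑ p, christoffelTrace (Pi.basis β) G p u * christoffelVec (Pi.basis β) G p u =
      ∑ k, ∑ p, (φ (σ k) (u (σ k)))⁻¹ *
        (blockTrace (β k) (h k) (φ k) (Fintype.card (ν (σ.symm k))) p (u k) *
        blockVec (β k) (h k) (φ k) (Fintype.card (ν (σ.symm k))) p (u k)) := by
    rw [Fintype.sum_sigma]
    refine Finset.sum_congr rfl fun k _ => Finset.sum_congr rfl fun p _ => ?_
    rw [hG.vec_eq hu, hG.trace_eq hu]
    ring
  have e4 : ∑ p, ∑ e, (G u)⁻¹ p e *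
      (logDerivMetric (Pi.basis β) G p u * logDerivMetric (Pi.basis β) G e u).trace =
      ∑ k, ∑ p, ∑ e, (φ (σ k) (u (σ k)))⁻¹ * ((h k (u k))⁻¹ p e *
        ((logDerivMetric (β k) (h k) p (u k) * logDerivMetric (β k) (h k) e (u k)).trace +
          Fintype.card (ν (σ.symm k)) *
          (logPartialDeriv (β k) (φ k) p (u k) * logPartialDeriv (β k) (φ k) e (u k)))) := by
    rw [hG.inv_eq hu, sum_blockDiagonal'_mul]
    refine Finset.sum_congr rfl fun k _ => Finset.sum_congr rfl fun c _ =>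
      Finset.sum_congr rfl fun e _ => ?_
    rw [hG.logDeriv hu, hG.logDeriv hu, trace_blockDiagonal'_single_mul (hG.ne_symm k),
      Matrix.smul_apply, smul_eq_mul, mul_assoc]
  have e5 : ∑ a, ∑ c, ∑ p, ∑ e, logDerivMetric (Pi.basis β) G a u c p * (G u)⁻¹ p e *
        logDerivMetric (Pi.basis β) G c u a e =
      ∑ k, ∑ a, ∑ c, ∑ p, ∑ e, (φ (σ k) (u (σ k)))⁻¹ *
        (logDerivMetric (β k) (h k) a (u k) c p * (h k (u k))⁻¹ p e *
          logDerivMetric (β k) (h k) c (u k) a e) := by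
    rw [Fintype.sum_sigma]
    refine Finset.sum_congr rfl fun k _ => Finset.sum_congr rfl fun a _ => ?_
    -- The three block diagonal factors link `c` to `p`, `p` to `e` and `e` to block `k`, so all
    -- indices lie in block `k` and the scalar blocks never enter.
    have z : ∀ c p e : Σ i, ν i, (c.1 ≠ k ∨ p.1 ≠ k ∨ e.1 ≠ k) →
        logDerivMetric (Pi.basis β) G ⟨k, a⟩ u c p * (G u)⁻¹ p e *
          logDerivMetric (Pi.basis β) G c u ⟨k, a⟩ e = 0 := by
      rintro c p e hne
      by_cases he : k = e.1
      · by_cases hpe : p.1 = e.1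
        · have hc : c.1 ≠ p.1 := by
            rw [hpe, ← he]
            rcases hne with h | h | h
            · exact h
            · exact absurd (hpe.trans he.symm) h
            · exact absurd he.symm h
          rw [hG.logDeriv_apply_ne hu _ hc, zero_mul, zero_mul]
        · rw [hG.inv_eq hu, Matrix.blockDiagonal'_apply _ p e, dif_neg hpe, mul_zero, zero_mul]
      · rw [hG.logDeriv_apply_ne hu c (y := ⟨k, a⟩) he, mul_zero]
    rw [sum_sigma_eq_sum_block k _ fun c hc => Finset.sum_eq_zero fun p _ =>
      Finset.sum_eq_zero fun e _ => z c p e (.inl hc)]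
    refine Finset.sum_congr rfl fun c _ => ?_
    rw [sum_sigma_eq_sum_block k _ fun p hp =>
      Finset.sum_eq_zero fun e _ => z ⟨k, c⟩ p e (.inr (.inl hp))]
    refine Finset.sum_congr rfl fun p _ => ?_
    rw [sum_sigma_eq_sum_block k _ fun e he => z ⟨k, c⟩ ⟨k, p⟩ e (.inr (.inr he))]
    refine Finset.sum_congr rfl fun e _ => ?_
    rw [hG.logDeriv_apply_same hu, hG.logDeriv_apply_same hu, hG.inv_eq hu,
      Matrix.blockDiagonal'_apply_eq, Matrix.smul_apply, smul_eq_mul]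
    ring
  rw [scalarCoord_eq hUo hu (contDiffOn_blockDiagonal'_apply hG.smooth hG.smooth_scale hG.eq),
    e1, e2, e3, e4, e5]
  · simp only [← Finset.mul_sum]
    rw [Finset.mul_sum, Finset.mul_sum, ← Finset.sum_sub_distrib, ← Finset.sum_add_distrib,
      ← Finset.sum_sub_distrib, ← Finset.sum_add_distrib]
    refine Finset.sum_congr rfl fun k _ => ?_
    rw [blockScalar]
    ring
  · exact fun v hv => (Matrix.isUnit_det_of_left_inverse
      (inv_blockDiagonal'_smul hG.det_ne hG.scale_ne hG.eq hv)).ne_zero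
  · intro v hv
    rw [hG.eq v hv, Matrix.IsSymm, Matrix.blockDiagonal'_transpose]
    congr 1
    funext i
    rw [Matrix.transpose_smul, hG.symm i _ (hv i trivial)]

end IsTwistedProduct
end ProductScalar

/-! ### The metric of one factor in a chart -/

section Factor

variable {n : ℕ} {N : Type*} [TopologicalSpace N] [ChartedSpace (EuclideanSpace ℝ (Fin n)) N]
  [IsManifold (𝓡 n) ∞ N]

/-- The matrix of a Riemannian metric in the preferred chart around `p`. -/
def coordMetric (g : RiemMetric n N) (p : N) (u : EuclideanSpace ℝ (Fin n)) :
    Matrix (Fin n) (Fin n) ℝ :=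
  Matrix.of fun a c =>
    g.inner ((extChartAt (𝓡 n) p).symm u)
      (mfderiv 𝓘(ℝ, EuclideanSpace ℝ (Fin n)) (𝓡 n) (extChartAt (𝓡 n) p).symm u
        ((EuclideanSpace.basisFun (Fin n) ℝ).toBasis a))
      (mfderiv 𝓘(ℝ, EuclideanSpace ℝ (Fin n)) (𝓡 n) (extChartAt (𝓡 n) p).symm u
        ((EuclideanSpace.basisFun (Fin n) ℝ).toBasis c))

theorem coordMetric_isSymm (g : RiemMetric n N) (p : N) (u : EuclideanSpace ℝ (Fin n)) :
    (coordMetric g p u).IsSymm := by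
  ext a c
  exact g.symm _ _ _

theorem isInvertible_mfderiv_extChartAt_symm {p : N} {u : EuclideanSpace ℝ (Fin n)}
    (hu : u ∈ (extChartAt (𝓡 n) p).target) :
    (mfderiv 𝓘(ℝ, EuclideanSpace ℝ (Fin n)) (𝓡 n) (extChartAt (𝓡 n) p).symm u).IsInvertible := by
  have h := isInvertible_mfderivWithin_extChartAt_symm (I := 𝓡 n) hu
  rwa [ModelWithCorners.range_eq_univ, mfderivWithin_univ] at h

/-- A kernel vector `v` would give a nonzero tangent vector `A w` of length zero. -/
theorem coordMetric_det_ne_zero (g : RiemMetric n N) {p : N} {u : EuclideanSpace ℝ (Fin n)}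
    (hu : u ∈ (extChartAt (𝓡 n) p).target) : (coordMetric g p u).det ≠ 0 := by
  intro h0
  obtain ⟨v, hv, hv0⟩ := Matrix.exists_mulVec_eq_zero_iff.2 h0
  set A := mfderiv 𝓘(ℝ, EuclideanSpace ℝ (Fin n)) (𝓡 n) (extChartAt (𝓡 n) p).symm u with hA
  set b := (EuclideanSpace.basisFun (Fin n) ℝ).toBasis
  set w : EuclideanSpace ℝ (Fin n) := ∑ a, v a • b a with hw
  have h1 : g.inner _ (A w) (A w) = ∑ a, v a * (coordMetric g p u).mulVec v a := by
    have h2 : A w = ∑ a, v a • A (b a) := by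
      rw [hw]
      exact (map_sum A _ _).trans (Finset.sum_congr rfl fun a _ => map_smul A _ _)
    rw [h2]
    simp only [map_sum, map_smul, sum_apply, smul_apply, Matrix.mulVec, dotProduct,
      Finset.mul_sum, smul_eq_mul]
    rw [Finset.sum_comm]
    refine Finset.sum_congr rfl fun a _ => Finset.sum_congr rfl fun c _ => ?_
    have h6 : coordMetric g p u a c = g.inner _ (A (b a)) (A (b c)) := rfl
    rw [h6]
    ring
  have h3 : w ≠ 0 := by
    intro hw0
    apply hv
    have := Fintype.linearIndependent_iff.1 b.linearIndependent v hw0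
    exact funext this
  have h4 : A w ≠ 0 := fun h =>
    h3 ((isInvertible_mfderiv_extChartAt_symm hu).injective (h.trans (map_zero A).symm))
  have h5 := g.pos _ _ h4
  rw [h1, hv0] at h5
  simp at h5

theorem contDiffOn_coordMetric (g : RiemMetric n N) (p : N) (a c : Fin n) :
    ContDiffOn ℝ ∞ (fun u => coordMetric g p u a c) (extChartAt (𝓡 n) p).target := by
  have ho : IsOpen (extChartAt (𝓡 n) p).target := isOpen_extChartAt_target p
  have hs : ContMDiffOn 𝓘(ℝ, EuclideanSpace ℝ (Fin n)) (𝓡 n) ∞ (extChartAt (𝓡 n) p).symm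
    (extChartAt (𝓡 n) p).target := contMDiffOn_extChartAt_symm p
  have hv : ∀ a, ContMDiffOn 𝓘(ℝ, EuclideanSpace ℝ (Fin n)) (𝓡 n).tangent ∞
      (fun u => (⟨(extChartAt (𝓡 n) p).symm u,
        mfderiv 𝓘(ℝ, EuclideanSpace ℝ (Fin n)) (𝓡 n) (extChartAt (𝓡 n) p).symm u
        ((EuclideanSpace.basisFun (Fin n) ℝ).toBasis a)⟩ : TangentBundle (𝓡 n) N))
      (extChartAt (𝓡 n) p).target := by
    intro a
    -- A coordinate vector field is the tangent map of the inverse chart applied to a constant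
    -- field.
    have h1 := hs.contMDiffOn_tangentMapWithin (m := ∞) le_rfl ho.uniqueMDiffOn
    have h2 : ContMDiffOn 𝓘(ℝ, EuclideanSpace ℝ (Fin n))
        𝓘(ℝ, EuclideanSpace ℝ (Fin n)).tangent ∞
        (fun u => (⟨u, (EuclideanSpace.basisFun (Fin n) ℝ).toBasis a⟩ :
          TangentBundle 𝓘(ℝ, EuclideanSpace ℝ (Fin n)) (EuclideanSpace ℝ (Fin n))))
        (extChartAt (𝓡 n) p).target := fun u _ =>
      contMDiffWithinAt_vectorSpace_iff_contDiffWithinAt.2 contDiffWithinAt_const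
    refine (h1.comp h2 fun u hu => hu).congr fun u hu => ?_
    simp only [Function.comp, tangentMapWithin]
    rw [mfderivWithin_of_isOpen ho hu]
  intro u hu
  rw [← contMDiffWithinAt_iff_contDiffWithinAt]
  have : ContMDiffWithinAt 𝓘(ℝ, EuclideanSpace ℝ (Fin n)) ((𝓡 n).prod 𝓘(ℝ)) ∞
      (fun u => Bundle.TotalSpace.mk' ℝ (E := Bundle.Trivial N ℝ) ((extChartAt (𝓡 n) p).symm u)
        (coordMetric g p u a c)) (extChartAt (𝓡 n) p).target u := by
    apply ContMDiffWithinAt.clm_bundle_apply₂ (F₁ := EuclideanSpace ℝ (Fin n))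
      (F₂ := EuclideanSpace ℝ (Fin n))
    · exact ContMDiffAt.comp_contMDiffWithinAt u g.contMDiff.contMDiffAt (hs u hu)
    · exact hv a u hu
    · exact hv c u hu
  simp only [Bundle.contMDiffWithinAt_totalSpace] at this
  exact this.2

end Factor

/-! ### Product manifolds and the block form of the multiconformal metric -/

section PiManifold

variable {l : ℕ} {m : Fin l → ℕ} {M : Fin l → Type*} [∀ i, TopologicalSpace (M i)]
  [∀ i, ChartedSpace (EuclideanSpace ℝ (Fin (m i))) (M i)]

theorem extChartAt_pi_apply (x y : ∀ i, M i) (i : Fin l) :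
    extChartAt (prodModel m) x y i = extChartAt (𝓡 (m i)) (x i) (y i) := rfl

theorem extChartAt_pi_symm_apply (x : ∀ i, M i) (u : ∀ i, EuclideanSpace ℝ (Fin (m i)))
    (i : Fin l) :
    (extChartAt (prodModel m) x).symm u i = (extChartAt (𝓡 (m i)) (x i)).symm (u i) := rfl

theorem range_prodModel : Set.range (prodModel m) = Set.univ :=
  Set.eq_univ_of_forall fun u => ⟨u, rfl⟩

variable {E H N : Type*} [NormedAddCommGroup E] [NormedSpace ℝ E] [TopologicalSpace H]
  {I : ModelWithCorners ℝ E H} [TopologicalSpace N] [ChartedSpace H N]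

theorem contMDiffAt_pi {F : N → ∀ i, M i} {p : N}
    (hF : ∀ i, ContMDiffAt I (𝓡 (m i)) ∞ (fun q => F q i) p) :
    ContMDiffAt I (prodModel m) ∞ F p := by
  rw [contMDiffAt_iff]
  refine ⟨continuousAt_pi.2 fun i => (hF i).continuousAt, contDiffWithinAt_pi.2 fun i => ?_⟩
  exact (contMDiffAt_iff.1 (hF i)).2

theorem contMDiff_pi_apply (i : Fin l) :
    ContMDiff (prodModel m) (𝓡 (m i)) ∞ (fun y : ∀ i, M i => y i) := by
  intro x
  rw [contMDiffAt_iff]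
  refine ⟨(continuous_apply i).continuousAt, ?_⟩
  have h1 := (contMDiffAt_iff.1 (contMDiffAt_id (I := 𝓡 (m i)) (n := ∞) (x := x i))).2
  rw [ModelWithCorners.range_eq_univ, contDiffWithinAt_univ] at h1
  rw [range_prodModel, contDiffWithinAt_univ]
  have h2 : ContDiffAt ℝ ∞ (fun v : ∀ i, EuclideanSpace ℝ (Fin (m i)) => v i)
      (extChartAt (prodModel m) x x) :=
    (ContinuousLinearMap.proj (R := ℝ) (φ := fun i => EuclideanSpace ℝ (Fin (m i)))
      i).contDiff.contDiffAt
  have h3 := ContDiffAt.comp (f := fun v : ∀ i, EuclideanSpace ℝ (Fin (m i)) => v i)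
    (extChartAt (prodModel m) x x) h1 h2
  exact h3

theorem contMDiff_update (x : ∀ i, M i) (k : Fin l) :
    ContMDiff (𝓡 (m k)) (prodModel m) ∞ (fun y : M k => Function.update x k y) := by
  intro y
  refine contMDiffAt_pi fun i => ?_
  by_cases hik : i = k
  · subst hik
    simp only [Function.update_self]
    exact contMDiffAt_id
  · simpa [Function.update_of_ne hik] using contMDiffAt_const

variable [∀ i, IsManifold (𝓡 (m i)) ∞ (M i)]

/-- Projecting after the inverse product chart is the same as applying the factor's inverse chart
after projecting. The chain rule (`key`) then reduces each summand to one factor. -/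
theorem metricMatrix_eq (g : ∀ i, RiemMetric (m i) (M i)) (f : Fin l → (∀ i, M i) → ℝ)
    (x : ∀ i, M i) {u : ∀ i, EuclideanSpace ℝ (Fin (m i))}
    (hu : u ∈ Set.univ.pi fun i => (extChartAt (𝓡 (m i)) (x i)).target) :
    metricMatrix (prodModel m) (prodBasis m) (multiconformalMetric g f) x u =
      Matrix.blockDiagonal' fun i => f i ((extChartAt (prodModel m) x).symm u) ^ 2 •
        coordMetric (g i) (x i) (u i) := by
  have hs : ∀ k, MDifferentiableAt 𝓘(ℝ, EuclideanSpace ℝ (Fin (m k))) (𝓡 (m k))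
      (extChartAt (𝓡 (m k)) (x k)).symm (u k) := fun k =>
    mdifferentiableAt_of_isInvertible_mfderiv
      (isInvertible_mfderiv_extChartAt_symm (hu k trivial))
  have hp : ∀ k, HasMFDerivAt 𝓘(ℝ, ∀ i, EuclideanSpace ℝ (Fin (m i)))
      𝓘(ℝ, EuclideanSpace ℝ (Fin (m k))) (fun v : ∀ i, EuclideanSpace ℝ (Fin (m i)) => v k) u
      (ContinuousLinearMap.proj k) := fun k =>
    (hasFDerivAt_apply k u).hasMFDerivAt
  have hS : MDifferentiableAt 𝓘(ℝ, ∀ i, EuclideanSpace ℝ (Fin (m i))) (prodModel m)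
      (extChartAt (prodModel m) x).symm u := by
    refine (contMDiffAt_pi fun k => ?_ : ContMDiffAt _ _ ∞ _ _).mdifferentiableAt (by simp)
    exact ((contMDiffOn_extChartAt_symm (I := 𝓡 (m k)) (n := ∞) (x k)).contMDiffAt
      ((isOpen_extChartAt_target (x k)).mem_nhds (hu k trivial))).comp u
      (ContinuousLinearMap.proj (R := ℝ) (φ := fun i => EuclideanSpace ℝ (Fin (m i)))
        k).contMDiff.contMDiffAt
  have key : ∀ k (w : ∀ i, EuclideanSpace ℝ (Fin (m i))),
      mfderiv (prodModel m) (𝓡 (m k)) (fun y : ∀ i, M i => y k)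
        ((extChartAt (prodModel m) x).symm u)
        (mfderiv 𝓘(ℝ, ∀ i, EuclideanSpace ℝ (Fin (m i))) (prodModel m)
          (extChartAt (prodModel m) x).symm u w) =
      mfderiv 𝓘(ℝ, EuclideanSpace ℝ (Fin (m k))) (𝓡 (m k))
        (extChartAt (𝓡 (m k)) (x k)).symm (u k) (w k) := by
    intro k w
    have h1 := mfderiv_comp u ((contMDiff_pi_apply (M := M) k).mdifferentiableAt (by simp)) hS
    have h2 := ((hs k).hasMFDerivAt.comp u (hp k)).mfderiv
    exact congrArg (fun T => T w) (h1.symm.trans h2)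
  have hb_same : ∀ i a, prodBasis m ⟨i, a⟩ i = (EuclideanSpace.basisFun (Fin (m i)) ℝ).toBasis a :=
    fun i a => by simp [prodBasis]
  have hb_ne : ∀ k i a, i ≠ k → prodBasis m ⟨i, a⟩ k = 0 := fun k i a h => by
    simp [prodBasis, h]
  have h0 : ∀ k, mfderiv 𝓘(ℝ, EuclideanSpace ℝ (Fin (m k))) (𝓡 (m k))
      (extChartAt (𝓡 (m k)) (x k)).symm (u k) (0 : EuclideanSpace ℝ (Fin (m k))) = 0 := fun k =>
    map_zero (mfderiv 𝓘(ℝ, EuclideanSpace ℝ (Fin (m k))) (𝓡 (m k))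
      (extChartAt (𝓡 (m k)) (x k)).symm (u k))
  ext ⟨i, a⟩ ⟨j, c⟩
  have h1 : metricMatrix (prodModel m) (prodBasis m) (multiconformalMetric g f) x u ⟨i, a⟩ ⟨j, c⟩ =
      ∑ k, f k ((extChartAt (prodModel m) x).symm u) ^ 2 *
        (g k).inner ((extChartAt (𝓡 (m k)) (x k)).symm (u k))
          (mfderiv 𝓘(ℝ, EuclideanSpace ℝ (Fin (m k))) (𝓡 (m k))
            (extChartAt (𝓡 (m k)) (x k)).symm (u k) (prodBasis m ⟨i, a⟩ k))
          (mfderiv 𝓘(ℝ, EuclideanSpace ℝ (Fin (m k))) (𝓡 (m k))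
            (extChartAt (𝓡 (m k)) (x k)).symm (u k) (prodBasis m ⟨j, c⟩ k)) := by
    rw [metricMatrix, Matrix.of_apply, multiconformalMetric, LinearMap.mk₂_apply]
    refine Finset.sum_congr rfl fun k _ => ?_
    rw [← key, ← key]
    rfl
  rw [h1, Finset.sum_eq_single i]
  · by_cases hij : i = j
    · subst hij
      rw [Matrix.blockDiagonal'_apply_eq, hb_same, hb_same]
      rfl
    · rw [Matrix.blockDiagonal'_apply', dif_neg hij, hb_ne i j c (Ne.symm hij), h0, map_zero,
        mul_zero]
  · intro k _ hk
    rw [hb_ne k i a (Ne.symm hk), h0, map_zero, zero_apply, mul_zero]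
  · exact fun h => absurd (Finset.mem_univ i) h

end PiManifold

/-! ### The separated functional equation -/

section Separation

variable {κ : Type*} [Fintype κ] [DecidableEq κ] {X : κ → Type*} {a S : ∀ k, X k → ℝ}
  {σ : Equiv.Perm κ} {c : ℝ}

theorem variation_eq_zero_of_sum_eq (hσ : ∀ i, σ i ≠ i)
    (h : ∀ x : ∀ k, X k, ∑ k, a (σ k) (x (σ k)) * S k (x k) = c) (k : κ) (y z : X k)
    (x : ∀ k, X k) :
    a (σ k) (x (σ k)) * (S k y - S k z) +
      (a k y - a k z) * S (σ.symm k) (x (σ.symm k)) = 0 := by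
  have hk : k ≠ σ.symm k := fun e => hσ k (by rw [e]; simpa using e)
  have h1 := (h (Function.update x k y)).trans (h (Function.update x k z)).symm
  -- Only the terms with index `k` and `σ⁻¹ k` involve the coordinate `x k`.
  rw [← sub_eq_zero, ← Finset.sum_sub_distrib, Fintype.sum_eq_add k (σ.symm k) hk] at h1
  · have e1 : ∀ w, a (σ k) (Function.update x k w (σ k)) = a (σ k) (x (σ k)) := fun w => by
      rw [Function.update_of_ne (hσ k)]
    have e2 : ∀ w, S (σ.symm k) (Function.update x k w (σ.symm k)) =
        S (σ.symm k) (x (σ.symm k)) := fun w => by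
      rw [Function.update_of_ne hk.symm]
    have e3 : ∀ w j, j = k → a j (Function.update x k w j) = a k w := by
      rintro w _ rfl
      rw [Function.update_self]
    rw [e1, e1, e2, e2, e3 _ _ (σ.apply_symm_apply k), e3 _ _ (σ.apply_symm_apply k),
      Function.update_self, Function.update_self] at h1
    linarith
  · rintro i ⟨hi, hi'⟩
    have : σ i ≠ k := fun e => hi' (by rw [← e, σ.symm_apply_apply])
    rw [Function.update_of_ne hi, Function.update_of_ne hi, Function.update_of_ne this,
      Function.update_of_ne this, sub_self]

theorem eq_zero_of_sum_eq (hσ : ∀ i, σ i ≠ i) (ha : ∀ k, ∃ y z, a k y ≠ a k z)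
    (h : ∀ x : ∀ k, X k, ∑ k, a (σ k) (x (σ k)) * S k (x k) = c) : c = 0 := by
  choose y z hyz using ha
  have key : ∀ (k : κ) (x : ∀ k, X k), a (σ k) (x (σ k)) * (S k (y k) - S k (z k)) +
      (a k (y k) - a k (z k)) * S (σ.symm k) (x (σ.symm k)) = 0 := fun k x =>
    variation_eq_zero_of_sum_eq hσ h k (y k) (z k) x
  have hA : ∀ k, a k (y k) - a k (z k) ≠ 0 := fun k => sub_ne_zero.2 (hyz k)
  -- In the relation at `σ j`, the coordinates at `σ (σ j)` and `j` vary independently. Varying the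
  -- first kills the variation of `S (σ j)`, and what remains forces `S j w = 0`.
  have vanish : ∀ j, σ (σ j) ≠ j → ∀ w, S j w = 0 := by
    intro j hj w
    have h1 : ∀ v, a (σ (σ j)) v * (S (σ j) (y (σ j)) - S (σ j) (z (σ j))) +
        (a (σ j) (y (σ j)) - a (σ j) (z (σ j))) * S j w = 0 := fun v => by
      have := key (σ j) (Function.update (Function.update y j w) (σ (σ j)) v)
      rw [Function.update_self, σ.symm_apply_apply, Function.update_of_ne hj.symm,
        Function.update_self] at this
      exact this
    have h2 := h1 (y _)
    have h3 := h1 (z _)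
    have h4 : (a (σ (σ j)) (y _) - a (σ (σ j)) (z _)) *
        (S (σ j) (y (σ j)) - S (σ j) (z (σ j))) = 0 := by linarith
    rw [(mul_eq_zero.1 h4).resolve_left (hA _), mul_zero, zero_add] at h2
    exact (mul_eq_zero.1 h2).resolve_left (hA _)
  have pair : ∀ (k : κ) (x : ∀ k, X k), a (σ k) (x (σ k)) * S k (x k) +
      a (σ (σ k)) (x (σ (σ k))) * S (σ k) (x (σ k)) = 0 := by
    intro k x
    by_cases hk : σ (σ k) = k
    · have hs : σ.symm k = σ k := by rw [Equiv.symm_apply_eq, hk]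
      have h1 := key k
      rw [hs] at h1
      have h2 := key (σ k)
      rw [hk, σ.symm_apply_apply] at h2
      rw [hk]
      have ey := h2 (Function.update x k (y k))
      have ez := h2 (Function.update x k (z k))
      rw [Function.update_self] at ey ez
      apply mul_left_cancel₀ (mul_ne_zero (hA k) (hA (σ k)))
      -- On a 2-cycle, `h1` and `h2` solve for `S (σ k)` and `S k` as multiples of `a (σ k)` and `a
      -- k`; `ey - ez` says that the two multipliers are opposite.
      linear_combination (a (σ k) (y (σ k)) - a (σ k) (z (σ k))) * a k (x k) * h1 x +
        (a k (y k) - a k (z k)) * a (σ k) (x (σ k)) * h2 x -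
        a k (x k) * a (σ k) (x (σ k)) * (ey - ez)
    · rw [vanish k hk, vanish (σ k) fun e => hk (σ.injective e), mul_zero, mul_zero, add_zero]
  have h1 := h y
  have h2 : ∑ k, a (σ (σ k)) (y (σ (σ k))) * S (σ k) (y (σ k)) = c :=
    (Equiv.sum_comp σ fun k => a (σ k) (y (σ k)) * S k (y k)).trans h1
  have h3 := Finset.sum_eq_zero fun k (_ : k ∈ Finset.univ) => pair k y
  rw [Finset.sum_add_distrib, h1, h2] at h3
  linarith

end Separation

/-! ### Scalar curvature of the multiconformal product -/

section MulticonformalProduct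

variable {l : ℕ} {m : Fin l → ℕ} {M : Fin l → Type*} [∀ i, TopologicalSpace (M i)]
  [∀ i, ChartedSpace (EuclideanSpace ℝ (Fin (m i))) (M i)] [∀ i, IsManifold (𝓡 (m i)) ∞ (M i)]

/-- The scalar curvature of a multiconformal product in which `f i` is the pullback of a function
`φ (σ i)` on the factor `M (σ i)`. -/
theorem scalarCurvature_multiconformalMetric (g : ∀ i, RiemMetric (m i) (M i))
    {f : Fin l → (∀ i, M i) → ℝ} {φ : ∀ i, M i → ℝ}
    (hφ : ∀ i, ContMDiff (𝓡 (m i)) 𝓘(ℝ, ℝ) ∞ (φ i)) (hφ0 : ∀ i y, φ i y ≠ 0)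
    {σ : Equiv.Perm (Fin l)} (hσ : ∀ i, σ i ≠ i) (hf : ∀ i x, f i x = φ (σ i) (x (σ i)))
    (x : ∀ i, M i) :
    scalarCurvature (prodModel m) (prodBasis m) (multiconformalMetric g f) x =
      ∑ k, (φ (σ k) (x (σ k)) ^ 2)⁻¹ *
        blockScalar (EuclideanSpace.basisFun (Fin (m k)) ℝ).toBasis (coordMetric (g k) (x k))
          (fun u => φ k ((extChartAt (𝓡 (m k)) (x k)).symm u) ^ 2)
          (Fintype.card (Fin (m (σ.symm k)))) (extChartAt (𝓡 (m k)) (x k) (x k)) := by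
  have hprod : IsTwistedProduct (fun i => (extChartAt (𝓡 (m i)) (x i)).target)
      (fun i => coordMetric (g i) (x i))
      (fun i u => φ i ((extChartAt (𝓡 (m i)) (x i)).symm u) ^ 2) σ
      (metricMatrix (prodModel m) (prodBasis m) (multiconformalMetric g f) x) := by
    refine ⟨hσ, fun i => isOpen_extChartAt_target (x i),
      fun i => contDiffOn_coordMetric (g i) (x i),
      fun i y hy => coordMetric_det_ne_zero (g i) hy, fun i y _ => coordMetric_isSymm (g i) (x i) y,
      fun i => (contMDiffOn_iff_contDiffOn.1
        ((hφ i).comp_contMDiffOn (contMDiffOn_extChartAt_symm (x i)))).pow 2,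
      fun i y _ => pow_ne_zero 2 (hφ0 i _), fun v hv => ?_⟩
    rw [metricMatrix_eq g f x hv]
    simp only [hf, extChartAt_pi_symm_apply]
  have hu : extChartAt (prodModel m) x x ∈
      Set.univ.pi fun i => (extChartAt (𝓡 (m i)) (x i)).target := fun i _ =>
    mem_extChartAt_target (x i)
  refine (hprod.scalarCoord_eq_sum hu).trans (Finset.sum_congr rfl fun k _ => ?_)
  simp only [extChartAt_pi_apply, extChartAt_to_inv]

end MulticonformalProduct

end MulticonformalScalar

end

/-! ### The main theorem -/

theorem mainTheorem6 {l : ℕ} (m : Fin l → ℕ) (M : Fin l → Type*)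
    [∀ i, TopologicalSpace (M i)]
    [∀ i, ChartedSpace (EuclideanSpace ℝ (Fin (m i))) (M i)]
    [∀ i, IsManifold (𝓡 (m i)) ∞ (M i)]
    (g : ∀ i, MulticonformalScalar.RiemMetric (m i) (M i))
    (f : Fin l → (∀ i, M i) → ℝ)
    (hf_smooth : ∀ i, ContMDiff (MulticonformalScalar.prodModel m) 𝓘(ℝ, ℝ) ∞ (f i))
    (hf_pos : ∀ i x, 0 < f i x)
    (σ : Equiv.Perm (Fin l)) (hσ : ∀ i, σ i ≠ i)
    (hf_dep : ∀ i, ∀ x y : ∀ j, M j, x (σ i) = y (σ i) → f i x = f i y)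
    (hf_nonconst : ∀ i, ¬ ∃ c : ℝ, ∀ x, f i x = c)
    (hR : ∃ c : ℝ, ∀ x : ∀ j, M j,
      MulticonformalScalar.scalarCurvature (MulticonformalScalar.prodModel m)
        (MulticonformalScalar.prodBasis m)
        (MulticonformalScalar.multiconformalMetric g f) x = c) :
    ∀ x : ∀ j, M j,
      MulticonformalScalar.scalarCurvature (MulticonformalScalar.prodModel m)
        (MulticonformalScalar.prodBasis m)
        (MulticonformalScalar.multiconformalMetric g f) x = 0 := by
  intro x₀
  obtain ⟨c, hc⟩ := hR
  -- The function on `M k` through which `f (σ⁻¹ k)` factors, read off on the slice through `x₀`.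
  let φ : ∀ k, M k → ℝ := fun k y => f (σ.symm k) (Function.update x₀ k y)
  have hf : ∀ i x, f i x = φ (σ i) (x (σ i)) := fun i x => by
    simp only [φ, Equiv.symm_apply_apply]
    exact hf_dep i _ _ (by rw [Function.update_self])
  have hφ : ∀ k, ContMDiff (𝓡 (m k)) 𝓘(ℝ, ℝ) ∞ (φ k) := fun k =>
    (hf_smooth (σ.symm k)).comp (MulticonformalScalar.contMDiff_update x₀ k)
  have hpos : ∀ k y, 0 < φ k y := fun k y => hf_pos _ _
  have hne : ∀ k, ∃ y z, (φ k y ^ 2)⁻¹ ≠ (φ k z ^ 2)⁻¹ := by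
    intro k
    obtain ⟨i, rfl⟩ := σ.surjective k
    by_contra! hk
    refine hf_nonconst i ⟨φ (σ i) (x₀ (σ i)), fun x => ?_⟩
    have h1 := hk (x (σ i)) (x₀ (σ i))
    rwa [inv_inj, pow_left_inj₀ (hpos _ _).le (hpos _ _).le two_ne_zero, ← hf] at h1
  rw [hc x₀]
  -- `S k y` is computed in the chart around `y` itself, so it is a function on `M k` though the
  -- chart changes with the point. No regularity of it in `y` is needed.
  refine MulticonformalScalar.eq_zero_of_sum_eq (a := fun k y => (φ k y ^ 2)⁻¹)
    (S := fun k y => MulticonformalScalar.blockScalar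
      (EuclideanSpace.basisFun (Fin (m k)) ℝ).toBasis (MulticonformalScalar.coordMetric (g k) y)
      (fun u => φ k ((extChartAt (𝓡 (m k)) y).symm u) ^ 2)
      (Fintype.card (Fin (m (σ.symm k)))) (extChartAt (𝓡 (m k)) y y)) hσ hne fun x => ?_
  exact (MulticonformalScalar.scalarCurvature_multiconformalMetric g hφ
    (fun k y => (hpos k y).ne') hσ hf x).symm.trans (hc x)
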